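/- Let $G_2$ denote the subgroup of a group $G$ generated by all commutators $ghg^{-1}h^{-1}$; $G$ is $2$-step nilpotent if $G_2$ is contained in the center of $G$. A $2$-step nilsystem is a compact space $X=G/\Gamma$, where $G$ is a $2$-step nilpotent Lie group and $\Gamma\subset G$ is a discrete cocompact subgroup, together with the translation $T\colon x\mapsto\tau\cdot x$ by an element $\tau\in G$. A basic $2$-step nilsequence is a sequence $(f(T^nx_0)\colon n\in\mathbb Z)$ with $(X,T)$ a $2$-step nilsystem, $f\colon X\to\mathbb C$ continuous and $x_0\in X$; a $2$-step nilsequence is a uniform limit (over $n\in\mathbb Z$) of basic $2$-step nilsequences. A basic elementary nilsequence is a sequence $(f(T^nx_0)\colon n\in\mathbb Z)$ where $(X=G/\Gamma,T)$ is a $2$-step nilsystem with an identification, as topological groups, of $G_2$ with the circle group $\mathbb S^1\subset\mathbb C$, $x_0\in X$, and $f\colon X\to\mathbb C$ is continuous with $f(u\cdot x)=u\,f(x)$ for all $u\in G_2=\mathbb S^1$ and all $x\in X$. An elementary nilsequence is a uniform limit of basic elementary nilsequences, or an almost periodic sequence, i.e. a sequence $(f(\tau^n)\colon n\in\mathbb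 Z)$ with $f$ a continuous function on a compact abelian group and $\tau$ an element of this group. **Proposition.** Every $2$-step nilsequence is a uniform limit of finite sums of elementary nilsequences. Moreover, every $2$-step nilsequence is a uniform limit of finite sums of basic elementary nilsequences. -/

import Mathlib

open scoped Manifold ContDiff Topology

namespace TwoStepNil

/-- A topological group is a (real, finite-dimensional) Lie group if it is Hausdorff and its
topology comes from a smooth manifold structure without boundary for which multiplication and
inversion are smooth. No connectedness or countability of components is required. -/
def IsRealLieGroup (G : Type) [Group G] [TopologicalSpace G] : Prop :=
  T2Space G ∧
    ∃ (E : Type) (_ : NormedAddCommGroup E) (_ : NormedSpace ℝ E) (_ : FiniteDimensional ℝ E)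
      (H : Type) (_ : TopologicalSpace H) (I : ModelWithCorners ℝ E H) (_ : I.Boundaryless)
      (_ : ChartedSpace H G), LieGroup I ∞ G

/-- A `2`-step nilsystem: a `2`-step nilpotent Lie group `G` (its commutator subgroup is central),
a discrete cocompact subgroup `Γ`, and an element `τ` of `G` acting on `X = G / Γ` by left
translation. -/
structure Nilsystem where
  G : Type
  [group : Group G]
  [topology : TopologicalSpace G]
  isLie : IsRealLieGroup G
  twoStep : commutator G ≤ Subgroup.center G
  Γ : Subgroup G
  discrete : DiscreteTopology Γ
  cocompact : CompactSpace (G ⧸ Γ)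
  τ : G

attribute [instance] Nilsystem.group Nilsystem.topology

/-- The nilmanifold `X = G / Γ`, with the quotient topology and the left translation action
of `G`. -/
abbrev Nilsystem.X (N : Nilsystem) : Type := N.G ⧸ N.Γ

/-- The sequence `(f (τ ^ n • x₀))`, `n ∈ ℤ`. -/
noncomputable def Nilsystem.orbitSeq (N : Nilsystem) (f : C(N.X, ℂ)) (x₀ : N.X) : ℤ → ℂ :=
  fun n => f (N.τ ^ n • x₀)

/-- An elementary nilsystem: a `2`-step nilsystem together with an identification, as topological
groups, of the commutator subgroup `G₂` with the circle group. -/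
structure ElementaryNilsystem extends Nilsystem where
  circleIso : commutator G ≃ₜ* Circle

/-- The space `C₁(X)` of continuous functions `f` on `X` with `f (u • x) = u * f x` for all `u` in
`G₂`, identified with the circle, and all `x` in `X`. -/
def ElementaryNilsystem.C₁ (N : ElementaryNilsystem) : Set C(N.X, ℂ) :=
  {f | ∀ (u : commutator N.G) (x : N.X), f ((u : N.G) • x) = (N.circleIso u : ℂ) * f x}

/-- The sequence `a` is a uniform limit of sequences belonging to `S`. -/
def IsUniformLimitOf (S : Set (ℤ → ℂ)) (a : ℤ → ℂ) : Prop :=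
  ∃ b : ℕ → ℤ → ℂ, (∀ k, b k ∈ S) ∧ TendstoUniformly b a Filter.atTop

/-- The set of finite sums of sequences belonging to `S`. -/
def finiteSums (S : Set (ℤ → ℂ)) : Set (ℤ → ℂ) :=
  {a | ∃ (k : ℕ) (b : Fin k → ℤ → ℂ), (∀ i, b i ∈ S) ∧ a = ∑ i, b i}

/-- Basic `2`-step nilsequences. -/
def basicNilsequences : Set (ℤ → ℂ) :=
  {a | ∃ (N : Nilsystem) (f : C(N.X, ℂ)) (x₀ : N.X), a = N.orbitSeq f x₀}

/-- `2`-step nilsequences: uniform limits of basic ones. -/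
def IsNilsequence (a : ℤ → ℂ) : Prop :=
  IsUniformLimitOf basicNilsequences a

/-- Basic elementary nilsequences. -/
def basicElementaryNilsequences : Set (ℤ → ℂ) :=
  {a | ∃ (N : ElementaryNilsystem) (f : C(N.X, ℂ)) (x₀ : N.X),
    f ∈ N.C₁ ∧ a = N.orbitSeq f x₀}

/-- Almost periodic sequences: those of the form `f (τ ^ n)` with `f` a continuous function on a
compact (Hausdorff) abelian group and `τ` an element of it. -/
def IsAlmostPeriodic (a : ℤ → ℂ) : Prop :=
  ∃ (K : Type) (_ : CommGroup K) (_ : TopologicalSpace K) (_ : IsTopologicalGroup K)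
    (_ : CompactSpace K) (_ : T2Space K) (τ : K) (f : C(K, ℂ)), ∀ n : ℤ, a n = f (τ ^ n)

/-- Elementary nilsequences: uniform limits of basic elementary nilsequences and, by convention,
all almost periodic sequences. -/
def elementaryNilsequences : Set (ℤ → ℂ) :=
  {a | IsUniformLimitOf basicElementaryNilsequences a ∨ IsAlmostPeriodic a}

end TwoStepNil

/-! Let `H` be the closure of `ΓG₂`. Commutators of elements of `H` lie in `Γ`, so `H/Γ` and `G/H`
are compact abelian groups. Since characters separate points of compact abelian groups
(`exists_character_ne_one`), Stone–Weierstrass reduces the problem to functions `f` on `G/Γ` with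
`f(gh) = χ(h) f(g)` for a character `χ` of `H`.

Moving `τ^n` past `u` in the orbit of such an `f` costs the phase `χ[τ,u]^n`. Suppose a second
equivariant function `f'`, on a nilmanifold with translation `τ'`, produces the inverse phase
whenever small `u`, `u'` satisfy `u ∈ τ^m H` and `u' ∈ τ'^m H'`. Then the phases cancel in `f(τ^n x)
f'(τ'^n x')`, the translates of this sequence are totally bounded, and by Bochner's theorem it is a
uniform limit of trigonometric polynomials (`mul_orbit_mem_unifClosure_expSeq`).

The second system is a Heisenberg-type model, built in `exists_model`. For `m` in a Bohr set, `τ^m`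
agrees modulo `H` with a small `g_m`. The logarithms of `χ[τ,g_m]` and `χ[g_m,g_m']` are bounded and
locally additive, hence linear and bilinear in the Bohr coordinates of `m`, `m'`. They define a
bilinear form on a finite-dimensional space `V`. Triviality of `χ` on commutators of elements of `H`
says that a certain cocompact lattice of `V` is isotropic modulo integers. The circle extension of
`V` splits over that lattice, and this gives a compact nilmanifold whose group has commutator
subgroup exactly the circle.

On the model there are finitely many functions `b_i`, equivariant for the splitting, and
conjugate-equivariant `d_i` with `∑ d_i b_i = 1`. Then `f = ∑ (f d_i) b_i` along the orbits, each `f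
d_i` is a limit of trigonometric polynomials, and an exponential times `b_i` is again basic
elementary, because the phase is absorbed in the central part of `τ'`. The trivial character is
treated in the same way, so almost periodic sequences need no separate role. -/

namespace TwoStepNil

/-! ### Characters of compact abelian groups and Stone–Weierstrass -/

section PeterWeyl

open MeasureTheory

/-- A commuting unitary representation in a C⋆-algebra which is norm continuous after
multiplication by a self-adjoint element `T` has enough characters to detect its action on `T`. -/
theorem exists_character_of_cstar {K : Type*} [CommGroup K] [TopologicalSpace K]
    [IsTopologicalGroup K] {A : Type*} [CStarAlgebra A] (U : K →* A)
    (hU : ∀ x, star (U x) = U x⁻¹) (T : A) (hT : star T = T) (hTU : ∀ x, T * U x = U x * T)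
    (hcont : Continuous fun x => U x * T) {x₀ : K} (hx₀ : U x₀ * T ≠ T) :
    ∃ χ : K →ₜ* Circle, χ x₀ ≠ 1 := by
  classical
  set S : Set A := Set.range U ∪ {T} with hS
  have hstar : star S = S := by
    ext a
    simp only [hS, Set.mem_star, Set.mem_union, Set.mem_range, Set.mem_singleton_iff]
    constructor
    · rintro (⟨x, hx⟩ | h)
      · exact Or.inl ⟨x⁻¹, by rw [← hU, hx, star_star]⟩
      · exact Or.inr (by rw [← star_star a, h, hT])
    · rintro (⟨x, rfl⟩ | rfl)
      · exact Or.inl ⟨x⁻¹, (hU x).symm⟩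
      · exact Or.inr hT
  have hcomm : ∀ a ∈ S, ∀ b ∈ S, a * b = b * a := by
    rintro _ (⟨x, rfl⟩ | rfl) _ (⟨y, rfl⟩ | rfl)
    · rw [← map_mul, mul_comm, map_mul]
    · exact (hTU x).symm
    · exact hTU y
    · rfl
  -- The bicommutant of a commuting self-adjoint set is a commutative C⋆-algebra, so Gelfand's
  -- theorem supplies enough characters.
  set B : StarSubalgebra ℂ A :=
    StarSubalgebra.centralizer ℂ (StarSubalgebra.centralizer ℂ S : Set A) with hB
  have hBcoe : (B : Set A) = S.centralizer.centralizer := by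
    rw [hB, StarSubalgebra.coe_centralizer_centralizer, hstar, Set.union_self]
  have hSB : S ⊆ B := by rw [hBcoe]; exact Set.subset_centralizer_centralizer
  have hclosed : IsClosed (B : Set A) := by rw [hBcoe]; exact Set.isClosed_centralizer _
  have hBcomm : ∀ a b : B, a * b = b * a := by
    rintro ⟨a, ha⟩ ⟨b, hb⟩
    ext
    rw [← SetLike.mem_coe, hBcoe] at ha hb
    exact Set.centralizer_centralizer_comm_of_comm hcomm _ ha _ hb
  have := hclosed
  let _ : CommCStarAlgebra B := { (inferInstance : CStarAlgebra B) with mul_comm := hBcomm }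
  let u : K →* B :=
    { toFun := fun x => ⟨U x, hSB (Or.inl ⟨x, rfl⟩)⟩
      map_one' := Subtype.ext (map_one U)
      map_mul' := fun x y => Subtype.ext (map_mul U x y) }
  let t : B := ⟨T, hSB (Or.inr rfl)⟩
  have hne : u x₀ * t - t ≠ 0 := fun h => hx₀ (congrArg Subtype.val (sub_eq_zero.1 h))
  have hg : WeakDual.gelfandTransform ℂ B (u x₀ * t - t) ≠ 0 := by
    rw [Ne, map_eq_zero_iff _ (gelfandTransform_isometry B).injective]
    exact hne
  obtain ⟨φ, hφ⟩ : ∃ φ : WeakDual.characterSpace ℂ B, φ (u x₀ * t - t) ≠ 0 := by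
    by_contra! h
    exact hg (ContinuousMap.ext h)
  rw [map_sub, map_mul] at hφ
  -- Only `x ↦ U x * T` is norm continuous. Dividing by the nonzero number `φ t` transfers the
  -- continuity to `x ↦ φ (u x)`.
  have ht : φ t ≠ 0 := fun h => hφ (by simp [h])
  have hnorm : ∀ x, φ (u x) ∈ Submonoid.unitSphere ℂ := by
    intro x
    have h1 : star (u x) * u x = 1 := by
      apply Subtype.ext
      change star (U x) * U x = 1
      rw [hU, ← map_mul, inv_mul_cancel, map_one]
    have h2 : star (φ (u x)) * φ (u x) = 1 := by
      rw [← map_star φ, ← map_mul, h1, map_one]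
    have h3 : (‖φ (u x)‖ : ℂ) ^ 2 = 1 := by
      rw [← h2, Complex.star_def, Complex.conj_mul']
    have h4 : ‖φ (u x)‖ ^ 2 = 1 := by exact_mod_cast h3
    have : ‖φ (u x)‖ = 1 := by
      nlinarith [norm_nonneg (φ (u x))]
    simpa [Submonoid.unitSphere] using this
  have hc : Continuous fun x => φ (u x) := by
    have h1 : Continuous fun x => u x * t := hcont.subtype_mk _
    have h2 : Continuous fun x => φ (u x * t) := (map_continuous φ).comp h1
    have h3 : (fun x => φ (u x)) = fun x => φ (u x * t) / φ t := by
      funext x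
      rw [map_mul, mul_div_cancel_right₀ _ ht]
    rw [h3]
    exact h2.div_const _
  refine ⟨⟨{ toFun := fun x => (⟨φ (u x), hnorm x⟩ : Submonoid.unitSphere ℂ)
             map_one' := Subtype.ext (by simp)
             map_mul' := fun x y => Subtype.ext
               (show φ (u (x * y)) = φ (u x) * φ (u y) by rw [map_mul, map_mul]) }, hc.subtype_mk _⟩, ?_⟩
  intro h
  have : φ (u x₀) = 1 := congrArg (fun z : Circle => (z : ℂ)) h
  rw [this] at hφ
  simp at hφ

/-- The operator `∫ k y • U y` attached to a continuous function `k` on a compact group and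
a strongly continuous family of contractions. -/
noncomputable def integratedRep {K : Type*} [TopologicalSpace K] [CompactSpace K]
    [MeasurableSpace K] [BorelSpace K] (μ : Measure K) [IsProbabilityMeasure μ]
    {E : Type*} [NormedAddCommGroup E] [InnerProductSpace ℂ E] [CompleteSpace E]
    (U : K → E →L[ℂ] E) (hc : ∀ v, Continuous fun x => U x v) (hn : ∀ x v, ‖U x v‖ ≤ ‖v‖) :
    C(K, ℂ) →L[ℂ] E →L[ℂ] E :=
  have hi : ∀ (k : C(K, ℂ)) (v : E), Integrable (fun y => k y • U y v) μ := fun k v =>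
    (k.continuous.smul (hc v)).integrable_of_hasCompactSupport (HasCompactSupport.of_compactSpace _)
  LinearMap.mkContinuous₂
    (LinearMap.mk₂ ℂ (fun (k : C(K, ℂ)) (v : E) => ∫ y, k y • U y v ∂μ)
      (fun k l v => by
        simp only [ContinuousMap.add_apply, add_smul]; exact integral_add (hi k v) (hi l v))
      (fun c k v => by
        simp only [ContinuousMap.smul_apply, smul_assoc]; exact integral_smul _ _)
      (fun k v w => by
        simp only [map_add, smul_add]; exact integral_add (hi k v) (hi k w))
      (fun c k v => by
        simp only [map_smul, smul_comm _ c]; exact integral_smul _ _)) 1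
    (fun k v => by
      simp only [LinearMap.mk₂_apply]
      refine (norm_integral_le_of_norm_le_const (C := ‖k‖ * ‖v‖) (.of_forall fun y => ?_)).trans ?_
      · rw [norm_smul]
        exact mul_le_mul (k.norm_coe_le_norm y) (hn y v) (norm_nonneg _) (norm_nonneg _)
      · simp)

/-- A nontrivial action of a compact abelian group by a strongly continuous unitary
representation is detected by a character. -/
theorem exists_character_of_rep {K : Type*} [CommGroup K] [TopologicalSpace K]
    [IsTopologicalGroup K] [CompactSpace K] [MeasurableSpace K] [BorelSpace K] (μ : Measure K)
    [IsProbabilityMeasure μ] [μ.IsMulLeftInvariant] [μ.IsInvInvariant] [μ.IsOpenPosMeasure]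
    {E : Type*} [NormedAddCommGroup E] [InnerProductSpace ℂ E] [CompleteSpace E]
    (U : K →* E →L[ℂ] E) (hU : ∀ x, star (U x) = U x⁻¹)
    (hc : ∀ v, Continuous fun x => U x v) {x₀ : K} (hx₀ : U x₀ ≠ 1) :
    ∃ χ : K →ₜ* Circle, χ x₀ ≠ 1 := by
  have hinner : ∀ x v w, inner ℂ (U x v) w = inner ℂ v (U x⁻¹ w) := by
    intro x v w
    rw [← hU, ContinuousLinearMap.star_eq_adjoint, ContinuousLinearMap.adjoint_inner_right]
  have hUU : ∀ x y v, U x (U y v) = U (x * y) v := fun x y v => by rw [map_mul]; rfl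
  have hn : ∀ x v, ‖U x v‖ ≤ ‖v‖ := by
    intro x v
    have : inner ℂ (U x v) (U x v) = inner ℂ v v := by
      rw [hinner, hUU, inv_mul_cancel, map_one]; rfl
    rw [inner_self_eq_norm_sq_to_K, inner_self_eq_norm_sq_to_K] at this
    have h2 : ‖U x v‖ ^ 2 = ‖v‖ ^ 2 := by exact_mod_cast this
    exact ((sq_eq_sq₀ (norm_nonneg _) (norm_nonneg _)).1 h2).le
  obtain ⟨v, hv⟩ : ∃ v, U x₀ v ≠ v := by
    by_contra! h
    exact hx₀ (ContinuousLinearMap.ext h)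
  set ψ : E := U x₀ v - v with hψ
  -- This positive-definite kernel makes `R k` self-adjoint, with `⟨ψ, R k ψ⟩ = ∫ |⟨ψ, U y ψ⟩|² >
  -- 0`. Since `R k ψ = U x₀ (R k v) - R k v`, the element `x₀` acts nontrivially on the range of `R
  -- k`.
  let k : C(K, ℂ) := ⟨fun y => inner ℂ (U y ψ) ψ, (hc ψ).inner continuous_const⟩
  have hi : ∀ (k : C(K, ℂ)) (v : E), Integrable (fun y => k y • U y v) μ := fun k v =>
    (k.continuous.smul (hc v)).integrable_of_hasCompactSupport (HasCompactSupport.of_compactSpace _)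
  let R := integratedRep μ U hc hn
  have hR : ∀ k v, R k v = ∫ y, k y • U y v ∂μ := fun _ _ => rfl
  have hRU : ∀ k x, R k * U x = U x * R k := by
    intro k x
    ext w
    change R k (U x w) = U x (R k w)
    rw [hR, hR, ← ContinuousLinearMap.integral_comp_comm _ (hi k w)]
    refine integral_congr_ae (.of_forall fun y => ?_)
    change k y • U y (U x w) = U x (k y • U y w)
    rw [map_smul, hUU, hUU, mul_comm]
  -- `U` is only strongly continuous, but composing with `R k` amounts to translating the kernel,
  -- and translates of `k` vary continuously in the sup norm.
  have hshift : ∀ k : C(K, ℂ), ∀ x, U x * R k =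
      R (k.comp ⟨fun y => x⁻¹ * y, by fun_prop⟩) := by
    intro k x
    ext w
    change U x (R k w) = _
    rw [hR, hR, ← ContinuousLinearMap.integral_comp_comm _ (hi k w)]
    refine Eq.trans ?_ (integral_mul_left_eq_self (fun y => k (x⁻¹ * y) • U y w) x)
    refine integral_congr_ae (.of_forall fun y => ?_)
    change U x (k y • U y w) = k (x⁻¹ * (x * y)) • U (x * y) w
    rw [map_smul, hUU, inv_mul_cancel_left]
  refine exists_character_of_cstar U hU (R k) ?_ (hRU k) ?_ (x₀ := x₀) ?_
  · rw [ContinuousLinearMap.star_eq_adjoint]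
    symm
    rw [ContinuousLinearMap.eq_adjoint_iff]
    intro a b
    rw [hR, hR, ← inner_conj_symm, ← integral_inner (hi k a), ← integral_inner (hi k b),
      ← integral_conj, ← integral_inv_eq_self]
    refine integral_congr_ae (.of_forall fun y => ?_)
    have e1 : inner ℂ b (U y⁻¹ a) = inner ℂ (U y b) a := (hinner y b a).symm
    have e2 : inner ℂ (U y⁻¹ ψ) ψ = inner ℂ ψ (U y ψ) := by rw [hinner, inv_inv]
    change (starRingEnd ℂ) (inner ℂ b (inner ℂ (U y⁻¹ ψ) ψ • U y⁻¹ a)) =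
      inner ℂ a (inner ℂ (U y ψ) ψ • U y b)
    rw [inner_smul_right, inner_smul_right, map_mul, e1, e2, inner_conj_symm, inner_conj_symm]
  · rw [show (fun x => U x * R k) = fun x => R (k.comp ⟨fun y => x⁻¹ * y, by fun_prop⟩) from
      funext (hshift k)]
    refine R.continuous.comp ?_
    exact (ContinuousMap.curry ⟨fun p : K × K => k (p.1⁻¹ * p.2), by fun_prop⟩).continuous
  · intro h
    have h1 : R k ψ = 0 := by
      have h2 : (R k * U x₀) v = R k v := by rw [hRU, h]
      rw [hψ, map_sub, sub_eq_zero]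
      exact h2
    have h3 : ∫ y, ‖inner ℂ ψ (U y ψ)‖ ^ 2 ∂μ = 0 := by
      have : inner ℂ ψ (R k ψ) = 0 := by rw [h1, inner_zero_right]
      rw [hR, ← integral_inner (hi k ψ)] at this
      have h4 : (∫ y, (‖inner ℂ ψ (U y ψ)‖ ^ 2 : ℝ) ∂μ : ℂ) = 0 := by
        rw [← this]
        refine integral_congr_ae (.of_forall fun y => ?_)
        simp only [inner_smul_right, k, ContinuousMap.coe_mk]
        rw [← inner_conj_symm (U y ψ) ψ, Complex.conj_mul']
        push_cast; rfl
      exact_mod_cast h4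
    have hcont : Continuous fun y => ‖inner ℂ ψ (U y ψ)‖ ^ 2 := by
      have := hc ψ
      fun_prop
    rw [integral_eq_zero_iff_of_nonneg (fun y => by positivity)
      (hcont.integrable_of_hasCompactSupport (HasCompactSupport.of_compactSpace _))] at h3
    have h5 := (hcont.ae_eq_iff_eq μ continuous_const).1 h3
    have h6 := congrFun h5 1
    have h7 : ψ = 0 := by
      rw [map_one] at h6
      exact inner_self_eq_zero.1 (norm_eq_zero.1 (eq_zero_of_pow_eq_zero h6))
    exact hv (sub_eq_zero.1 h7)

/-- The characters of a compact Hausdorff abelian group separate its points. -/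
theorem exists_character_ne_one {K : Type*} [CommGroup K] [TopologicalSpace K]
    [IsTopologicalGroup K] [CompactSpace K] [T2Space K] {x₀ : K} (hx₀ : x₀ ≠ 1) :
    ∃ χ : K →ₜ* Circle, χ x₀ ≠ 1 := by
  borelize K
  let μ : Measure K := Measure.haarMeasure ⊤
  have : IsProbabilityMeasure μ := ⟨by
    have := Measure.haarMeasure_self (K₀ := (⊤ : TopologicalSpace.PositiveCompacts K))
    simpa using this⟩
  let E := Lp ℂ 2 μ
  let U : K →* E →L[ℂ] E :=
    { toFun := fun x => LinearMap.mkContinuous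
        { toFun := fun v => DomMulAct.mk x • v
          map_add' := smul_add _
          map_smul' := fun c v => smul_comm _ _ _ } 1 (fun v => by
          rw [one_mul]; exact (DomMulAct.norm_smul_Lp _ v).le)
      map_one' := by ext1 v; exact one_smul Kᵈᵐᵃ v
      map_mul' := fun x y => by
        ext1 v
        change DomMulAct.mk (x * y) • v = DomMulAct.mk x • DomMulAct.mk y • v
        rw [mul_comm, DomMulAct.mk_mul, mul_smul] }
  have hUa : ∀ x v, U x v = DomMulAct.mk x • v := fun _ _ => rfl
  refine exists_character_of_rep μ U ?_ ?_ (x₀ := x₀) ?_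
  · intro x
    rw [ContinuousLinearMap.star_eq_adjoint]
    symm
    rw [ContinuousLinearMap.eq_adjoint_iff]
    intro a b
    have hiso : ∀ (y : K) (a b : E), inner ℂ (U y a) (U y b) = inner ℂ a b := by
      intro y a b
      let V : E →ₗᵢ[ℂ] E := ⟨(U y).toLinearMap, fun v => DomMulAct.norm_smul_Lp _ v⟩
      exact V.inner_map_map a b
    rw [← hiso x, ← mul_apply_eq_comp, ← map_mul, mul_inv_cancel, map_one]
    rfl
  · intro v
    simp only [hUa]
    have : Fact ((2 : ENNReal) ≠ ⊤) := ⟨by simp⟩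
    have : Continuous fun x : K => DomMulAct.mk x := DomMulAct.continuous_mk
    fun_prop
  · intro h
    -- The regular representation is faithful: a continuous function with different values at `1`
    -- and `x₀` is moved by `x₀`, and almost everywhere equality of continuous functions is
    -- equality.
    obtain ⟨f, hf0, hf1, -⟩ := exists_continuous_zero_one_of_isClosed
      (isClosed_singleton (x := (1 : K))) (isClosed_singleton (x := x₀))
      (by simpa using hx₀.symm)
    let g : C(K, ℂ) := ⟨fun x => (f x : ℂ), by fun_prop⟩
    have hg : MemLp g 2 μ := g.continuous.memLp_of_hasCompactSupport
      (HasCompactSupport.of_compactSpace _)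
    have h1 : U x₀ (hg.toLp g) = hg.toLp g := by rw [h]; rfl
    rw [hUa, DomMulAct.mk_smul_toLp, MemLp.toLp_eq_toLp_iff] at h1
    have h2 := ((g.continuous.comp (continuous_const_smul x₀)).ae_eq_iff_eq μ g.continuous).1 h1
    have h3 := congrFun h2 1
    have e0 : f 1 = 0 := hf0 rfl
    have e1 : f x₀ = 1 := hf1 rfl
    simp [g, e0, e1] at h3

/-- A version of the Stone–Weierstrass theorem: the span of a point-separating multiplicative set
of functions which is stable under conjugation is uniformly dense. -/
theorem exists_mem_span_submonoid_near {X : Type*} [TopologicalSpace X] [CompactSpace X]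
    (S : Submonoid C(X, ℂ)) (hstar : ∀ f ∈ S, star f ∈ S)
    (hsep : ∀ x y, x ≠ y → ∃ f ∈ S, f x ≠ f y) (f : C(X, ℂ)) {ε : ℝ} (hε : 0 < ε) :
    ∃ g ∈ Submodule.span ℂ (S : Set C(X, ℂ)), ‖f - g‖ < ε := by
  let A : StarSubalgebra ℂ C(X, ℂ) := StarAlgebra.adjoin ℂ (S : Set C(X, ℂ))
  have hA : ∀ g ∈ A, g ∈ Submodule.span ℂ (S : Set C(X, ℂ)) := by
    intro g hg
    have h1 : (S : Set C(X, ℂ)) ∪ star (S : Set C(X, ℂ)) = S := by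
      refine Set.union_eq_left.2 fun h hh => ?_
      rw [← star_star h]
      exact hstar _ hh
    have h2 : g ∈ Algebra.adjoin ℂ (S : Set C(X, ℂ)) := by
      rw [← h1, ← StarAlgebra.adjoin_toSubalgebra]
      exact hg
    rw [← Subalgebra.mem_toSubmodule, Algebra.adjoin_eq_span, Submonoid.closure_eq] at h2
    exact h2
  have htop : A.topologicalClosure = ⊤ := by
    refine ContinuousMap.starSubalgebra_topologicalClosure_eq_top_of_separatesPoints A ?_
    intro x y hxy
    obtain ⟨f, hf, hne⟩ := hsep x y hxy
    exact ⟨f, ⟨f, StarAlgebra.subset_adjoin ℂ _ hf, rfl⟩, hne⟩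
  have hf : f ∈ closure (A : Set C(X, ℂ)) := by
    have : f ∈ A.topologicalClosure := by rw [htop]; trivial
    exact this
  obtain ⟨g, hg, hfg⟩ := Metric.mem_closure_iff.1 hf ε hε
  exact ⟨g, hA g hg, by rwa [← dist_eq_norm]⟩

/-- A character, as a continuous complex function. -/
noncomputable def characterFun {K : Type*} [Group K] [TopologicalSpace K] (χ : K →ₜ* Circle) : C(K, ℂ) :=
  ⟨fun x => (χ x : ℂ), continuous_induced_dom.comp χ.continuous_toFun⟩

theorem characterFun_apply {K : Type*} [Group K] [TopologicalSpace K] (χ : K →ₜ* Circle)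
    (x : K) : characterFun χ x = (χ x : ℂ) := rfl

/-- Trigonometric polynomials are dense in the continuous functions on a compact Hausdorff
abelian group. -/
theorem exists_mem_span_characterFun_near {K : Type*} [CommGroup K] [TopologicalSpace K]
    [IsTopologicalGroup K] [CompactSpace K] [T2Space K] (f : C(K, ℂ)) {ε : ℝ} (hε : 0 < ε) :
    ∃ g ∈ Submodule.span ℂ (Set.range (characterFun (K := K))), ‖f - g‖ < ε := by
  let S : Submonoid C(K, ℂ) :=
    { carrier := Set.range (characterFun (K := K))
      one_mem' := ⟨1, by ext x; rfl⟩
      mul_mem' := by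
        rintro _ _ ⟨χ, rfl⟩ ⟨ψ, rfl⟩
        exact ⟨χ * ψ, by ext x; rfl⟩ }
  refine exists_mem_span_submonoid_near S ?_ ?_ f hε
  · rintro _ ⟨χ, rfl⟩
    refine ⟨χ⁻¹, ?_⟩
    ext x
    exact Circle.coe_inv_eq_conj (χ x)
  · intro x y hxy
    obtain ⟨χ, hχ⟩ := exists_character_ne_one (x₀ := x / y) (by rwa [Ne, div_eq_one])
    refine ⟨_, ⟨χ, rfl⟩, fun h => hχ ?_⟩
    have h2 : χ x = χ y := Circle.ext h
    rw [map_div, h2, div_self']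

end PeterWeyl
-- Uniform closures of spans of sequences
/-- The sequences which are uniform limits of linear combinations of sequences in `S`. -/
def unifClosure (S : Set (ℤ → ℂ)) : Submodule ℂ (ℤ → ℂ) where
  carrier := {a | ∀ ε > 0, ∃ b ∈ Submodule.span ℂ S, ∀ n, ‖a n - b n‖ ≤ ε}
  zero_mem' := fun ε hε => ⟨0, Submodule.zero_mem _, fun n => by simpa using hε.le⟩
  add_mem' := by
    intro a a' ha ha' ε hε
    obtain ⟨b, hb, h⟩ := ha (ε / 2) (half_pos hε)
    obtain ⟨b', hb', h'⟩ := ha' (ε / 2) (half_pos hε)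
    refine ⟨b + b', Submodule.add_mem _ hb hb', fun n => ?_⟩
    calc ‖(a + a') n - (b + b') n‖ = ‖(a n - b n) + (a' n - b' n)‖ := by
          simp only [Pi.add_apply]; congr 1; ring
      _ ≤ ε / 2 + ε / 2 := (norm_add_le _ _).trans (add_le_add (h n) (h' n))
      _ = ε := add_halves ε
  smul_mem' := by
    intro r a ha ε hε
    obtain ⟨b, hb, h⟩ := ha (ε / (‖r‖ + 1)) (by positivity)
    refine ⟨r • b, Submodule.smul_mem _ _ hb, fun n => ?_⟩
    calc ‖(r • a) n - (r • b) n‖ = ‖r‖ * ‖a n - b n‖ := by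
          simp only [Pi.smul_apply, ← smul_sub, norm_smul]
      _ ≤ (‖r‖ + 1) * (ε / (‖r‖ + 1)) := by
          gcongr
          · linarith
          · exact h n
      _ = ε := by field_simp

theorem mem_unifClosure {S : Set (ℤ → ℂ)} {a : ℤ → ℂ} :
    a ∈ unifClosure S ↔ ∀ ε > 0, ∃ b ∈ Submodule.span ℂ S, ∀ n, ‖a n - b n‖ ≤ ε := Iff.rfl

theorem subset_unifClosure {S : Set (ℤ → ℂ)} {a : ℤ → ℂ} (ha : a ∈ S) : a ∈ unifClosure S :=
  fun ε hε => ⟨a, Submodule.subset_span ha, fun n => by simpa using hε.le⟩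

theorem mem_unifClosure_of_approx {S : Set (ℤ → ℂ)} {a : ℤ → ℂ}
    (h : ∀ ε > 0, ∃ b ∈ unifClosure S, ∀ n, ‖a n - b n‖ ≤ ε) : a ∈ unifClosure S := by
  intro ε hε
  obtain ⟨b, hb, h1⟩ := h (ε / 2) (half_pos hε)
  obtain ⟨b', hb', h2⟩ := hb (ε / 2) (half_pos hε)
  refine ⟨b', hb', fun n => ?_⟩
  calc ‖a n - b' n‖ = ‖(a n - b n) + (b n - b' n)‖ := by congr 1; ring
    _ ≤ ε / 2 + ε / 2 := (norm_add_le _ _).trans (add_le_add (h1 n) (h2 n))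
    _ = ε := add_halves ε

/-- If multiplication by the bounded sequence `b` maps `S` into `S'`, it maps the uniform closure
of the span of `S` into that of `S'`. -/
theorem mul_mem_unifClosure {S S' : Set (ℤ → ℂ)} {b : ℤ → ℂ} {C : ℝ} (hb : ∀ n, ‖b n‖ ≤ C)
    (hS : ∀ a ∈ S, a * b ∈ unifClosure S') {a : ℤ → ℂ} (ha : a ∈ unifClosure S) :
    a * b ∈ unifClosure S' := by
  have hC : 0 ≤ C := (norm_nonneg _).trans (hb 0)
  refine mem_unifClosure_of_approx fun ε hε => ?_
  obtain ⟨a', ha', h⟩ := ha (ε / (C + 1)) (by positivity)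
  refine ⟨a' * b, ?_, fun n => ?_⟩
  · clear h
    induction ha' using Submodule.span_induction with
    | mem x hx => exact hS x hx
    | zero => simp
    | add x y _ _ hx hy => rw [add_mul]; exact Submodule.add_mem _ hx hy
    | smul r x _ hx => rw [smul_mul_assoc]; exact Submodule.smul_mem _ r hx
  · calc ‖(a * b) n - (a' * b) n‖ = ‖a n - a' n‖ * ‖b n‖ := by
          rw [← norm_mul]; congr 1; simp only [Pi.mul_apply]; ring
      _ ≤ (ε / (C + 1)) * (C + 1) := by
          gcongr
          · exact h n
          · linarith [hb n]
      _ = ε := by field_simp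

/-- The sequence of powers of a complex number of modulus one. -/
noncomputable def expSeq (z : Circle) : ℤ → ℂ := fun n => ((z ^ n : Circle) : ℂ)

/-! ### Bochner's criterion for almost periodicity -/

section Bochner

open BoundedContinuousFunction UniformSpace

/-- The translate of a bounded sequence. -/
noncomputable def shiftSeq (c : ℤ →ᵇ ℂ) (m : ℤ) : ℤ →ᵇ ℂ := c.compContinuous ⟨fun n => n + m, by fun_prop⟩

theorem shiftSeq_apply (c : ℤ →ᵇ ℂ) (m n : ℤ) : shiftSeq c m n = c (n + m) := rfl

/-- The seminorm on `ℤ` measuring how far `m` is from being a period of `c`. -/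
noncomputable def shiftSeminorm (c : ℤ →ᵇ ℂ) : AddGroupSeminorm ℤ where
  toFun m := ‖shiftSeq c m - c‖
  map_zero' := by
    rw [norm_eq_zero, sub_eq_zero]; ext n; rw [shiftSeq_apply, add_zero]
  add_le' a b := by
    rw [norm_le (by positivity)]
    intro n
    calc ‖(shiftSeq c (a + b) - c) n‖
        = ‖(shiftSeq c a - c) (n + b) + (shiftSeq c b - c) n‖ := by
          simp only [BoundedContinuousFunction.sub_apply, shiftSeq_apply]
          rw [add_right_comm n b a, add_assoc n a b]; congr 1; ring
      _ ≤ _ := (norm_add_le _ _).trans (add_le_add (norm_coe_le_norm _ _) (norm_coe_le_norm _ _))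
  neg' a := by
    have key : ∀ a : ℤ, ‖shiftSeq c (-a) - c‖ ≤ ‖shiftSeq c a - c‖ := by
      intro a
      rw [norm_le (by positivity)]
      intro n
      calc ‖(shiftSeq c (-a) - c) n‖ = ‖(shiftSeq c a - c) (n + -a)‖ := by
            simp only [BoundedContinuousFunction.sub_apply, shiftSeq_apply]
            rw [neg_add_cancel_right, norm_sub_rev]
        _ ≤ _ := norm_coe_le_norm _ _
    exact le_antisymm (key a) (by simpa using key (-a))

/-- The group of integers with the group topology in which the almost periods of `c` are small. -/
def ShiftInt (_ : ℤ →ᵇ ℂ) : Type := ℤ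

instance (c : ℤ →ᵇ ℂ) : AddCommGroup (ShiftInt c) := inferInstanceAs (AddCommGroup ℤ)

noncomputable instance (c : ℤ →ᵇ ℂ) : SeminormedAddCommGroup (ShiftInt c) :=
  AddGroupSeminorm.toSeminormedAddCommGroup (shiftSeminorm c : AddGroupSeminorm (ShiftInt c))

/-- The identification of `ShiftInt c` with the integers. -/
def ShiftInt.toInt (c : ℤ →ᵇ ℂ) : ShiftInt c ≃+ ℤ := AddEquiv.refl ℤ

theorem ShiftInt.norm_eq (c : ℤ →ᵇ ℂ) (a : ShiftInt c) :
    ‖a‖ = ‖shiftSeq c (ShiftInt.toInt c a) - c‖ := rfl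

/-- **Bochner's theorem**: a bounded sequence whose set of translates is totally bounded is a
uniform limit of trigonometric polynomials. -/
theorem mem_unifClosure_expSeq_of_totallyBounded {c : ℤ → ℂ} {C : ℝ} (hC : ∀ n, ‖c n‖ ≤ C)
    (h : ∀ ε > 0, ∃ F : Finset ℤ, ∀ m, ∃ m' ∈ F, ∀ n, ‖c (n + m) - c (n + m')‖ ≤ ε) :
    c ∈ unifClosure (Set.range expSeq) := by
  let b : ℤ →ᵇ ℂ := ofNormedAddCommGroup c continuous_of_discreteTopology C hC
  have hb : ∀ n, b n = c n := fun _ => rfl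
  let Z := ShiftInt b
  let j : Z ≃+ ℤ := ShiftInt.toInt b
  have hnorm : ∀ (x y : Z) (n : ℤ), c (n + (j x - j y)) - c n = (shiftSeq b (j (x - y)) - b) n := by
    intro x y n
    rw [map_sub]; rfl
  have htb : TotallyBounded (Set.univ : Set Z) := by
    rw [Metric.totallyBounded_iff]
    intro ε hε
    obtain ⟨F, hF⟩ := h (ε / 2) (half_pos hε)
    refine ⟨j.symm '' F, F.finite_toSet.image _, fun x _ => ?_⟩
    obtain ⟨m', hm', hd⟩ := hF (j x)
    refine Set.mem_iUnion₂.2 ⟨j.symm m', ⟨m', hm', rfl⟩, ?_⟩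
    rw [Metric.mem_ball, dist_eq_norm, ShiftInt.norm_eq]
    refine lt_of_le_of_lt ((norm_le (half_pos hε).le).2 fun n => ?_) (half_lt_self hε)
    have := hd (n - m')
    rw [sub_add_cancel] at this
    rwa [← hnorm, AddEquiv.apply_symm_apply, ← add_sub_assoc, ← sub_add_eq_add_sub]
  -- By total boundedness the completion is a compact abelian group containing the image of `ℤ`
  -- densely. The sequence `c` is 1-Lipschitz for the seminorm, so it extends there, and characters
  -- of the completion restrict to exponential sequences.
  have hcomp : CompactSpace (Completion Z) := by
    refine ⟨?_⟩
    have h1 : TotallyBounded (closure (Set.range ((↑) : Z → Completion Z))) := by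
      rw [← Set.image_univ]
      exact (htb.image (Completion.uniformContinuous_coe Z)).closure
    rw [Completion.denseRange_coe.closure_range] at h1
    exact h1.isCompact_of_isClosed isClosed_univ
  have huc : UniformContinuous (fun x : Z => c (j x)) := by
    refine LipschitzWith.uniformContinuous (K := 1) (LipschitzWith.of_dist_le_mul fun x y => ?_)
    rw [NNReal.coe_one, one_mul, dist_eq_norm x y, ShiftInt.norm_eq, dist_eq_norm]
    have := norm_coe_le_norm (shiftSeq b (j (x - y)) - b) (j y)
    rw [← hnorm, add_sub_cancel] at this
    exact this
  let K := Multiplicative (Completion Z)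
  let f : C(K, ℂ) := ⟨fun x => Completion.extension (fun x : Z => c (j x)) x.toAdd,
    Completion.continuous_extension.comp continuous_toAdd⟩
  let ι₀ : ℤ →+ Completion Z := (Completion.toCompl (α := Z)).comp j.symm.toAddMonoidHom
  let ι : ℤ → K := fun n => Multiplicative.ofAdd (ι₀ n)
  have hι : ∀ n : ℤ, ι n = ι 1 ^ n := by
    intro n
    have : ι₀ n = n • ι₀ 1 := by rw [← map_zsmul, smul_eq_mul, mul_one]
    exact congrArg Multiplicative.ofAdd this
  have hf : ∀ n : ℤ, f (ι n) = c n := fun n =>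
    (Completion.extension_coe huc (j.symm n)).trans (by rw [j.apply_symm_apply])
  intro ε hε
  obtain ⟨g, hg, hfg⟩ := exists_mem_span_characterFun_near f hε
  refine ⟨fun n => g (ι n), ?_, fun n => ?_⟩
  · clear hfg
    induction hg using Submodule.span_induction with
    | mem x hx =>
      obtain ⟨χ, rfl⟩ := hx
      refine Submodule.subset_span ⟨χ (ι 1), funext fun n => ?_⟩
      rw [characterFun_apply, hι n, map_zpow, expSeq]
    | zero => exact Submodule.zero_mem _
    | add x y _ _ hx hy => exact Submodule.add_mem _ hx hy
    | smul r x _ hx => exact Submodule.smul_mem _ r hx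
  · rw [← hf n]
    exact ((f - g).norm_coe_le_norm (ι n)).trans hfg.le

end Bochner

/-- A bounded sequence whose translates depend, up to small errors, only on the
approximate location of a point of a compact space is a uniform limit of trigonometric
polynomials. -/
theorem mem_unifClosure_expSeq_of_compact {X : Type*} [TopologicalSpace X] [CompactSpace X]
    (p : ℤ → X) {c : ℤ → ℂ} {C : ℝ} (hC : ∀ n, ‖c n‖ ≤ C)
    (h : ∀ ε > 0, ∀ x : X, ∃ N ∈ 𝓝 x, ∀ m m', p m ∈ N → p m' ∈ N →
      ∀ n, ‖c (n + m) - c (n + m')‖ ≤ ε) :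
    c ∈ unifClosure (Set.range expSeq) := by
  classical
  refine mem_unifClosure_expSeq_of_totallyBounded hC fun ε hε => ?_
  choose N hN hNc using h ε hε
  obtain ⟨t, ht⟩ := CompactSpace.elim_nhds_subcover N hN
  -- One representative time per neighbourhood; the default `0` occurs only for neighbourhoods that
  -- `p` never visits.
  let r : X → ℤ := fun x => if hx : ∃ m, p m ∈ N x then hx.choose else 0
  refine ⟨t.image r, fun m => ?_⟩
  have : p m ∈ ⋃ x ∈ t, N x := by rw [ht]; trivial
  obtain ⟨x, hx, hm⟩ := Set.mem_iUnion₂.1 this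
  refine ⟨r x, Finset.mem_image_of_mem r hx, fun n => ?_⟩
  have hx' : ∃ m, p m ∈ N x := ⟨m, hm⟩
  have hr : p (r x) ∈ N x := by
    simp only [r, dif_pos hx']
    exact hx'.choose_spec
  exact hNc x m (r x) hm hr n

/-! ### Bounded locally additive functions are linear -/

section LocalAdditive

variable {A E : Type*} [AddCommGroup A] [NormedAddCommGroup E]

/-- `f` is additive as long as the values of the coordinate map `x`, which is itself locally
additive, stay in the ball of radius `δ`. -/
structure LocallyAdditive (x : A → E) (δ : ℝ) (f : A → ℝ) : Prop where
  map_zero : x 0 = 0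
  map_neg : ∀ a, ‖x a‖ < δ → x (-a) = -x a
  map_add : ∀ a b, ‖x a‖ < δ → ‖x b‖ < δ → ‖x a + x b‖ < δ → x (a + b) = x a + x b
  add : ∀ a b, ‖x a‖ < δ → ‖x b‖ < δ → ‖x a + x b‖ < δ → f (a + b) = f a + f b

namespace LocallyAdditive

variable {x : A → E} {δ : ℝ} {f : A → ℝ}

theorem zero (h : LocallyAdditive x δ f) (hδ : 0 < δ) : f 0 = 0 := by
  have := h.add 0 0 (by simpa [h.map_zero]) (by simpa [h.map_zero]) (by simpa [h.map_zero])
  simpa using this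

theorem neg (h : LocallyAdditive x δ f) (hδ : 0 < δ) {a : A} (ha : ‖x a‖ < δ) :
    f (-a) = -f a := by
  have := h.add a (-a) ha (by rwa [h.map_neg a ha, norm_neg])
    (by simpa [h.map_neg a ha])
  rw [add_neg_cancel, h.zero hδ] at this
  linarith

variable [NormedSpace ℝ E]

theorem zsmul (h : LocallyAdditive x δ f) (hδ : 0 < δ) {a : A} (ha : ‖x a‖ < δ) {e : ℤ}
    (he : |e| ≤ 1) : x (e • a) = (e : ℝ) • x a ∧ f (e • a) = e * f a := by
  obtain rfl | rfl | rfl : e = -1 ∨ e = 0 ∨ e = 1 := by rw [abs_le] at he; omega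
  · simp [h.neg hδ ha, h.map_neg a ha]
  · simp [h.zero hδ, h.map_zero]
  · simp

theorem sum (h : LocallyAdditive x δ f) (hδ : 0 < δ) {ι : Type*} (s : Finset ι) {a : ι → A}
    {δ' : ℝ} (ha : ∀ j, ‖x (a j)‖ < δ') (hs : s.card * δ' < δ) {e : ι → ℤ} (he : ∀ j, |e j| ≤ 1) :
    x (∑ j ∈ s, e j • a j) = ∑ j ∈ s, (e j : ℝ) • x (a j) ∧
      f (∑ j ∈ s, e j • a j) = ∑ j ∈ s, e j * f (a j) := by
  classical
  have hbound : ∀ j, ‖(e j : ℝ) • x (a j)‖ ≤ δ' := fun j => by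
    rw [norm_smul, Real.norm_eq_abs]
    have : |(e j : ℝ)| ≤ 1 := by exact_mod_cast he j
    calc _ ≤ 1 * ‖x (a j)‖ := by gcongr
      _ ≤ δ' := by rw [one_mul]; exact (ha j).le
  have hsum : ∀ t : Finset ι, ‖∑ j ∈ t, (e j : ℝ) • x (a j)‖ ≤ t.card * δ' := fun t => by
    simpa using norm_sum_le_of_le t (fun j _ => hbound j)
  induction s using Finset.induction_on with
  | empty => simp [h.zero hδ, h.map_zero]
  | insert i s hi ih =>
    have hδ' : 0 < δ' := (norm_nonneg _).trans_lt (ha i)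
    rw [Finset.card_insert_of_notMem hi] at hs
    push_cast at hs
    have hs0 : (0 : ℝ) ≤ s.card := Nat.cast_nonneg _
    obtain ⟨ih1, ih2⟩ := ih (by nlinarith)
    have hai : ‖x (a i)‖ < δ := (ha i).trans_le (by nlinarith)
    obtain ⟨h1, h2⟩ := h.zsmul hδ hai (he i)
    have c1 : ‖x (e i • a i)‖ < δ := by
      rw [h1]; exact (hbound i).trans_lt (by nlinarith)
    have c2 : ‖x (∑ j ∈ s, e j • a j)‖ < δ := by
      rw [ih1]; exact (hsum s).trans_lt (by nlinarith)
    have c3 : ‖x (e i • a i) + x (∑ j ∈ s, e j • a j)‖ < δ := by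
      have := hsum (insert i s)
      rw [Finset.sum_insert hi, Finset.card_insert_of_notMem hi] at this
      rw [h1, ih1]
      push_cast at this
      exact this.trans_lt hs
    rw [Finset.sum_insert hi, Finset.sum_insert hi, Finset.sum_insert hi,
      h.map_add _ _ c1 c2 c3, h.add _ _ c1 c2 c3, h1, h2, ih1, ih2]
    exact ⟨rfl, rfl⟩

/-- A bounded locally additive function respects the real linear relations between small values
of the coordinate map. -/
theorem sum_mul_eq_zero (h : LocallyAdditive x δ f) (hδ : 0 < δ) {C : ℝ}
    (hC : ∀ a, ‖x a‖ < δ → |f a| ≤ C) {ι : Type*} [Fintype ι] {a : ι → A} {δ' : ℝ}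
    (ha : ∀ j, ‖x (a j)‖ < δ') (hι : Fintype.card ι * δ' < δ) {c : ι → ℝ}
    (hc : ∑ j, c j • x (a j) = 0) : ∑ j, c j * f (a j) = 0 := by
  classical
  -- After scaling, consecutive integers nearest to `k * c j` differ by at most one, so each passage
  -- from `k` to `k + 1` is a small step.
  wlog hc1 : ∀ j, |c j| < 1 generalizing c
  · set M : ℝ := 1 + ∑ j, |c j| with hM
    have hM0 : 0 < M := by positivity
    have := this (c := fun j => M⁻¹ * c j)
      (by simp only [mul_smul, ← Finset.smul_sum, hc, smul_zero]) (fun j => by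
        rw [abs_mul, abs_of_pos (inv_pos.2 hM0), inv_mul_lt_iff₀ hM0, mul_one, hM]
        have : |c j| ≤ ∑ j, |c j| := Finset.single_le_sum (f := fun j => |c j|)
          (fun i _ => abs_nonneg _) (Finset.mem_univ j)
        linarith)
    simp only [mul_assoc, ← Finset.mul_sum] at this
    exact (mul_eq_zero.1 this).resolve_left (inv_pos.2 hM0).ne'
  rcases isEmpty_or_nonempty ι with hemp | ⟨⟨i₀⟩⟩
  · simp
  have hδ' : 0 < δ' := (norm_nonneg _).trans_lt (ha i₀)
  have hn1 : (1 : ℝ) ≤ Fintype.card ι := by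
    exact_mod_cast Fintype.card_pos_iff.2 ⟨i₀⟩
  -- Because `∑ c j • x (a j) = 0`, only rounding errors contribute to `∑ p k j • x (a j)`. This sum
  -- stays in the ball where additivity is available, for every `k`.
  let p : ℕ → ι → ℤ := fun k j => round (k * c j)
  have hp : ∀ k j, |(p k j : ℝ) - k * c j| ≤ 1 / 2 := fun k j => by
    rw [abs_sub_comm]; exact abs_sub_round _
  have hsmall : ∀ k, ‖∑ j, (p k j : ℝ) • x (a j)‖ < δ := fun k => by
    have e1 : ∑ j, (p k j : ℝ) • x (a j) = ∑ j, ((p k j : ℝ) - k * c j) • x (a j) := by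
      simp only [sub_smul, Finset.sum_sub_distrib, mul_smul, ← Finset.smul_sum, hc, smul_zero,
        sub_zero]
    rw [e1]
    refine lt_of_le_of_lt (norm_sum_le_of_le _ (f := fun j => _) (n := fun _ => δ') fun j _ => ?_) ?_
    · rw [norm_smul, Real.norm_eq_abs]
      calc _ ≤ 1 * ‖x (a j)‖ := by
            gcongr
            exact (hp k j).trans (by norm_num)
        _ ≤ δ' := by rw [one_mul]; exact (ha j).le
    · simpa using hι
  have main : ∀ k, x (∑ j, p k j • a j) = ∑ j, (p k j : ℝ) • x (a j) ∧
      f (∑ j, p k j • a j) = ∑ j, p k j * f (a j) := by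
    intro k
    induction k with
    | zero => simp [p, h.map_zero, h.zero hδ]
    | succ k ih =>
      obtain ⟨ih1, ih2⟩ := ih
      let e : ι → ℤ := fun j => p (k + 1) j - p k j
      have he : ∀ j, |e j| ≤ 1 := fun j => by
        have h1 := abs_le.1 (hp k j)
        have h2 := abs_le.1 (hp (k + 1) j)
        have h3 := abs_lt.1 (hc1 j)
        push_cast at h2
        have h4 : (e j : ℝ) < 2 := by simp only [e]; push_cast; linarith
        have h5 : (-2 : ℝ) < e j := by simp only [e]; push_cast; linarith
        have h6 : e j < 2 := by exact_mod_cast h4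
        have h7 : -2 < e j := by exact_mod_cast h5
        rw [abs_le]; omega
      obtain ⟨s1, s2⟩ := h.sum hδ Finset.univ ha (by simpa using hι) he
      have hsp : ∀ j, p (k + 1) j = p k j + e j := fun j => by simp [e]
      have c0 : ‖∑ j, (e j : ℝ) • x (a j)‖ < δ := by
        refine lt_of_le_of_lt (norm_sum_le_of_le _ (n := fun _ => δ') fun j _ => ?_) (by simpa using hι)
        rw [norm_smul, Real.norm_eq_abs]
        have : |(e j : ℝ)| ≤ 1 := by exact_mod_cast he j
        calc _ ≤ 1 * ‖x (a j)‖ := by gcongr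
          _ ≤ δ' := by rw [one_mul]; exact (ha j).le
      have e1 : ∑ j, p (k + 1) j • a j = ∑ j, p k j • a j + ∑ j, e j • a j := by
        simp only [hsp, add_smul, Finset.sum_add_distrib]
      have e2 : ∑ j, (p (k + 1) j : ℝ) • x (a j) =
          ∑ j, (p k j : ℝ) • x (a j) + ∑ j, (e j : ℝ) • x (a j) := by
        simp only [hsp, Int.cast_add, add_smul, Finset.sum_add_distrib]
      have e3 : ∑ j, (p (k + 1) j : ℝ) * f (a j) =
          ∑ j, (p k j : ℝ) * f (a j) + ∑ j, (e j : ℝ) * f (a j) := by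
        simp only [hsp, Int.cast_add, add_mul, Finset.sum_add_distrib]
      have c1 : ‖x (∑ j, p k j • a j)‖ < δ := by rw [ih1]; exact hsmall k
      have c2 : ‖x (∑ j, e j • a j)‖ < δ := by rw [s1]; exact c0
      have c3 : ‖x (∑ j, p k j • a j) + x (∑ j, e j • a j)‖ < δ := by
        rw [ih1, s1, ← e2]; exact hsmall (k + 1)
      rw [e1, e2, e3, h.map_add _ _ c1 c2 c3, h.add _ _ c1 c2 c3, ih1, ih2, s1, s2]
      exact ⟨rfl, rfl⟩
  -- The value of `f` at the `k`-th combination is `k * S` up to an error independent of `k`, while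
  -- it is bounded by `C`. This forces `S = 0`.
  by_contra hne
  set S := ∑ j, c j * f (a j) with hS
  have hSpos : 0 < |S| := abs_pos.2 hne
  have hbd : ∀ k : ℕ, k * |S| ≤ C + ∑ j, |f (a j)| := fun k => by
    have h1 : |∑ j, (p k j : ℝ) * f (a j)| ≤ C := by
      rw [← (main k).2]
      exact hC _ (by rw [(main k).1]; exact hsmall k)
    have h2 : |∑ j, ((p k j : ℝ) - k * c j) * f (a j)| ≤ ∑ j, |f (a j)| := by
      refine (Finset.abs_sum_le_sum_abs _ _).trans (Finset.sum_le_sum fun j _ => ?_)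
      rw [abs_mul]
      calc _ ≤ 1 * |f (a j)| := by
            gcongr
            exact (hp k j).trans (by norm_num)
        _ = _ := one_mul _
    have h3 : (k : ℝ) * S = ∑ j, (p k j : ℝ) * f (a j) -
        ∑ j, ((p k j : ℝ) - k * c j) * f (a j) := by
      rw [hS, Finset.mul_sum, ← Finset.sum_sub_distrib]
      exact Finset.sum_congr rfl fun j _ => by ring
    calc (k : ℝ) * |S| = |(k : ℝ) * S| := by rw [abs_mul, Nat.abs_cast]
      _ ≤ _ := by rw [h3]; exact (abs_sub _ _).trans (add_le_add h1 h2)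
  obtain ⟨k, hk⟩ := exists_nat_gt ((C + ∑ j, |f (a j)|) / |S|)
  rw [div_lt_iff₀ hSpos] at hk
  exact absurd (hbd k) (not_le.2 hk)

variable [FiniteDimensional ℝ E]

omit [FiniteDimensional ℝ E] in
theorem exists_linearMap_eq {ι F : Type*} [AddCommGroup F] [Module ℝ F] {v : ι → E}
    (hv : LinearIndependent ℝ v) (g : ι → F) : ∃ φ : E →ₗ[ℝ] F, ∀ i, φ (v i) = g i := by
  let B := Module.Basis.span hv
  obtain ⟨φ, hφ⟩ := LinearMap.exists_extend (B.constr ℝ g)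
  refine ⟨φ, fun i => ?_⟩
  have h1 : ((B i : Submodule.span ℝ (Set.range v)) : E) = v i :=
    congrArg Subtype.val (Module.Basis.span_apply hv i)
  rw [← h1, ← Submodule.subtype_apply, ← LinearMap.comp_apply, hφ, Module.Basis.constr_basis]

/-- A linearly independent family of small values of the coordinate map, with the same span as
all small values. -/
theorem exists_basis {A : Type*} (x : A → E) (δ' : ℝ) :
    ∃ (s : Set E) (_ : Fintype s) (a : s → A), LinearIndependent ℝ (fun v : s => (v : E)) ∧
      (∀ v, ‖x (a v)‖ < δ') ∧ (∀ v, x (a v) = v) ∧ Fintype.card s ≤ Module.finrank ℝ E ∧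
      ∀ b, ‖x b‖ < δ' → x b ∈ Submodule.span ℝ s := by
  obtain ⟨s, hs, hspan, hli⟩ := exists_linearIndependent ℝ (x '' {a | ‖x a‖ < δ'})
  have hfin : s.Finite := hli.setFinite
  let _ := hfin.fintype
  choose a ha hxa using fun v : s => hs v.2
  refine ⟨s, _, a, hli, ha, hxa, hli.fintype_card_le_finrank, fun b hb => ?_⟩
  rw [hspan]
  exact Submodule.subset_span ⟨b, hb, rfl⟩

/-- A bounded locally additive function is, near `0`, a linear function of the coordinates. -/
theorem exists_linear (h : LocallyAdditive x δ f) (hδ : 0 < δ) {C : ℝ}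
    (hC : ∀ a, ‖x a‖ < δ → |f a| ≤ C) {δ' : ℝ} (hδ' : (Module.finrank ℝ E + 1) * δ' < δ) :
    ∃ φ : E →ₗ[ℝ] ℝ, ∀ a, ‖x a‖ < δ' → f a = φ (x a) := by
  classical
  obtain ⟨s, _, a, hli, ha, hxa, hcard, hspan⟩ := exists_basis x δ'
  obtain ⟨φ, hφ⟩ := exists_linearMap_eq hli fun v => f (a v)
  refine ⟨φ, fun b hb => ?_⟩
  have hδ'0 : 0 < δ' := (norm_nonneg _).trans_lt hb
  have hmem := hspan b hb
  rw [← Subtype.range_coe (s := s), Submodule.mem_span_range_iff_exists_fun] at hmem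
  obtain ⟨c, hc⟩ := hmem
  -- The relation expresses `x b` in the basis, with coefficient `-1` at `b` itself. It involves at
  -- most `finrank + 1` elements, whence the factor in `hδ'`.
  have key := h.sum_mul_eq_zero hδ hC (ι := Option s) (a := fun o => o.elim b a) (δ' := δ')
    (c := fun o => o.elim (-1) c) (by rintro (_ | v); exacts [hb, ha v]) (by
      refine lt_of_le_of_lt ?_ hδ'
      rw [Fintype.card_option]
      push_cast
      have : (Fintype.card s : ℝ) ≤ Module.finrank ℝ E := by exact_mod_cast hcard
      gcongr) (by
      rw [Fintype.sum_option]
      simp [hxa, hc])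
  rw [Fintype.sum_option] at key
  simp only [Option.elim_none, Option.elim_some] at key
  rw [← hc, map_sum]
  simp only [map_smul, hφ, smul_eq_mul]
  linarith

/-- A bounded function which is locally additive in each variable is, near `0`, a bilinear
function of the coordinates. -/
theorem exists_bilinear {x : A → E} {δ : ℝ} (hδ : 0 < δ) {f : A → A → ℝ} {C : ℝ}
    (hC : ∀ a b, ‖x a‖ < δ → ‖x b‖ < δ → |f a b| ≤ C)
    (h₁ : ∀ b, ‖x b‖ < δ → LocallyAdditive x δ fun a => f a b)
    (h₂ : ∀ a, ‖x a‖ < δ → LocallyAdditive x δ (f a)) {δ' : ℝ}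
    (hδ' : (Module.finrank ℝ E + 1) * δ' < δ) :
    ∃ φ : E →ₗ[ℝ] E →ₗ[ℝ] ℝ, ∀ a b, ‖x a‖ < δ' → ‖x b‖ < δ' → f a b = φ (x a) (x b) := by
  classical
  have hlt : ∀ a, ‖x a‖ < δ' → ‖x a‖ < δ := fun a ha => by
    have : 0 < δ' := (norm_nonneg _).trans_lt ha
    have h0 : (0 : ℝ) ≤ Module.finrank ℝ E := Nat.cast_nonneg _
    nlinarith
  obtain ⟨s, _, a, hli, ha, hxa, hcard, hspan⟩ := exists_basis x δ'
  -- With a basis element in the second slot, `f` is linear in the first. Extending linearly in the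
  -- second slot gives the right form, because `f b` is itself linear and so is determined on the
  -- basis.
  choose ψ hψ using fun v : s =>
    (h₁ (a v) (hlt _ (ha v))).exists_linear hδ (fun b hb => hC b (a v) hb (hlt _ (ha v))) hδ'
  obtain ⟨Φ, hΦ⟩ := exists_linearMap_eq hli ψ
  refine ⟨Φ.flip, fun b b' hb hb' => ?_⟩
  obtain ⟨φ, hφ⟩ := (h₂ b (hlt _ hb)).exists_linear hδ (fun b' hb' => hC b b' (hlt _ hb) hb') hδ'
  rw [hφ b' hb', LinearMap.flip_apply]
  have heq : Set.EqOn φ (Φ.flip (x b)) s := fun v hv => by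
    have h1 := hφ (a ⟨v, hv⟩) (ha _)
    rw [hψ ⟨v, hv⟩ b hb, hxa] at h1
    rw [LinearMap.flip_apply, ← h1, ← hΦ ⟨v, hv⟩]
  exact LinearMap.eqOn_span heq (hspan b' hb')

end LocallyAdditive

end LocalAdditive

/-! ### Fourier analysis along the fibres of `G/Γ → G/H` -/

section Vertical

open MeasureTheory
open scoped commutatorElement

/-- `H` is a closed subgroup between `Γ` and `G` such that `G / H` and `H / Γ` are abelian
groups, where `Γ` is closed. -/
structure IsVerticalSubgroup {G : Type*} [Group G] [TopologicalSpace G] (Γ H : Subgroup G) :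
    Prop where
  isClosed_lattice : IsClosed (Γ : Set G)
  isClosed : IsClosed (H : Set G)
  le : Γ ≤ H
  commutator_le : commutator G ≤ H
  commutator_mem : ∀ h ∈ H, ∀ h' ∈ H, ⁅h, h'⁆ ∈ Γ

/-- Functions on `G / Γ` which transform under right translations by `H` according to `χ`. -/
def IsEquivariant {G : Type*} [Group G] [TopologicalSpace G] {Γ H : Subgroup G} (χ : H →ₜ* Circle)
    (f : C(G ⧸ Γ, ℂ)) : Prop :=
  ∀ (g : G) (h : H), f ((g * h : G) : G ⧸ Γ) = (χ h : ℂ) * f (g : G ⧸ Γ)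

/-- The inclusion of the fibre `H / Γ` into `G / Γ`. -/
def fiberMap {G : Type*} [Group G] (Γ H : Subgroup G) : H ⧸ Γ.subgroupOf H → G ⧸ Γ :=
  Quotient.map' Subtype.val fun a b hab => by
    rw [QuotientGroup.leftRel_apply] at hab ⊢; exact hab

theorem fiberMap_mk {G : Type*} [Group G] (Γ H : Subgroup G) (h : H) :
    fiberMap Γ H (h : H ⧸ Γ.subgroupOf H) = ((h : G) : G ⧸ Γ) := rfl

theorem commutatorElement_mem_commutator {G : Type*} [Group G] (g h : G) :
    ⁅g, h⁆ ∈ commutator G :=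
  Subgroup.commutator_mem_commutator (Subgroup.mem_top g) (Subgroup.mem_top h)

variable {G : Type*} [Group G] [TopologicalSpace G]

section IsTopologicalGroup

variable [IsTopologicalGroup G]

theorem t2Space_quotient {Γ : Subgroup G} (hΓ : IsClosed (Γ : Set G)) : T2Space (G ⧸ Γ) := by
  rw [t2Space_iff_of_isOpenQuotientMap (π := ((↑) : G → G ⧸ Γ))
    (QuotientGroup.isOpenQuotientMap_mk)]
  have : {q : G × G | (q.1 : G ⧸ Γ) = q.2} = (fun q : G × G => q.1⁻¹ * q.2) ⁻¹' Γ := by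
    ext q
    exact QuotientGroup.eq
  rw [this]
  exact hΓ.preimage (by fun_prop)

/-- Continuous functions on a compact homogeneous space are uniformly continuous for left
translations. -/
theorem exists_nhds_smul_close {Γ : Subgroup G} [CompactSpace (G ⧸ Γ)] (f : C(G ⧸ Γ, ℂ)) {ε : ℝ}
    (hε : 0 < ε) : ∃ U ∈ 𝓝 (1 : G), ∀ u ∈ U, ∀ x : G ⧸ Γ, ‖f (u • x) - f x‖ ≤ ε := by
  let F : C(G, C(G ⧸ Γ, ℂ)) :=
    ContinuousMap.curry ⟨fun p : G × (G ⧸ Γ) => f (p.1 • p.2) - f p.2, by fun_prop⟩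
  have h0 : F 1 = 0 := by ext x; simp [F]
  have h1 : F ⁻¹' Metric.closedBall 0 ε ∈ 𝓝 (1 : G) := by
    refine F.continuous.continuousAt ?_
    rw [h0]
    exact Metric.closedBall_mem_nhds 0 hε
  refine ⟨_, h1, fun u hu x => ?_⟩
  have h2 : ‖F u‖ ≤ ε := by simpa using hu
  exact ((F u).norm_coe_le_norm x).trans h2

end IsTopologicalGroup

namespace IsVerticalSubgroup

variable {Γ H : Subgroup G}

theorem normal_subgroupOf (hH : IsVerticalSubgroup Γ H) : (Γ.subgroupOf H).Normal := by
  refine ⟨fun n hn g => ?_⟩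
  rw [Subgroup.mem_subgroupOf] at hn ⊢
  have h1 := hH.commutator_mem g g.2 n n.2
  have h2 := Γ.mul_mem h1 hn
  simpa [commutatorElement_def] using h2

theorem normal (hH : IsVerticalSubgroup Γ H) : H.Normal := by
  refine ⟨fun n hn g => ?_⟩
  have h2 := H.mul_mem (hH.commutator_le (commutatorElement_mem_commutator g n)) hn
  simpa [commutatorElement_def] using h2

/-- The group structure on the fibre. -/
abbrev fiberCommGroup (hH : IsVerticalSubgroup Γ H) : CommGroup (H ⧸ Γ.subgroupOf H) :=
  have := hH.normal_subgroupOf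
  { (inferInstance : Group (H ⧸ Γ.subgroupOf H)) with
    mul_comm := fun x y => by
      induction x using QuotientGroup.induction_on with | _ a
      induction y using QuotientGroup.induction_on with | _ b
      change ((a * b : H) : H ⧸ Γ.subgroupOf H) = ((b * a : H) : H ⧸ Γ.subgroupOf H)
      rw [QuotientGroup.eq, Subgroup.mem_subgroupOf]
      have := hH.commutator_mem _ (H.inv_mem b.2) _ (H.inv_mem a.2)
      simpa [commutatorElement_def, mul_assoc] using this }

/-- The group structure on the base `G / H`. -/
abbrev baseCommGroup (hH : IsVerticalSubgroup Γ H) : CommGroup (G ⧸ H) :=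
  have := hH.normal
  { (inferInstance : Group (G ⧸ H)) with
    mul_comm := fun x y => by
      induction x using QuotientGroup.induction_on with | _ a
      induction y using QuotientGroup.induction_on with | _ b
      change ((a * b : G) : G ⧸ H) = ((b * a : G) : G ⧸ H)
      rw [QuotientGroup.eq]
      have := hH.commutator_le (commutatorElement_mem_commutator b⁻¹ a⁻¹)
      simpa [commutatorElement_def, mul_assoc] using this }

theorem compactSpace_base [CompactSpace (G ⧸ Γ)] (hH : IsVerticalSubgroup Γ H) :
    CompactSpace (G ⧸ H) := by
  let q : G ⧸ Γ → G ⧸ H := Quotient.map' id fun a b hab => by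
    rw [QuotientGroup.leftRel_apply] at hab ⊢; exact hH.le hab
  have hq : Continuous q := Continuous.quotient_map' continuous_id _
  have hs : Function.Surjective q := by
    intro x
    induction x using QuotientGroup.induction_on with | _ a
    exact ⟨(a : G ⧸ Γ), rfl⟩
  exact hs.compactSpace hq

variable [IsTopologicalGroup G]

/-- Since `Γ ≤ H`, the closed set `H` is saturated for the projection, so its image is closed;
openness of the projection identifies the topologies. Compactness and separation of `H/Γ` are
inherited from `G/Γ` in this way. -/
theorem isClosedEmbedding_fiberMap (hH : IsVerticalSubgroup Γ H) :
    Topology.IsClosedEmbedding (fiberMap Γ H) := by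
  have hcont : Continuous (fiberMap Γ H) :=
    Continuous.quotient_map' continuous_subtype_val _
  have hinj : Function.Injective (fiberMap Γ H) := by
    intro x y
    induction x using QuotientGroup.induction_on with | _ a
    induction y using QuotientGroup.induction_on with | _ b
    intro h
    rw [fiberMap_mk, fiberMap_mk, QuotientGroup.eq] at h
    rw [QuotientGroup.eq, Subgroup.mem_subgroupOf]
    exact h
  have hrange : Set.range (fiberMap Γ H) = ((↑) : G → G ⧸ Γ) '' H := by
    ext x
    constructor
    · rintro ⟨y, rfl⟩
      induction y using QuotientGroup.induction_on with | _ a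
      exact ⟨a, a.2, rfl⟩
    · rintro ⟨a, ha, rfl⟩
      exact ⟨((⟨a, ha⟩ : H) : H ⧸ Γ.subgroupOf H), rfl⟩
  have hpre : ∀ g : G, (g : G ⧸ Γ) ∈ ((↑) : G → G ⧸ Γ) '' H → g ∈ H := by
    rintro g ⟨a, ha, hag⟩
    rw [QuotientGroup.eq] at hag
    simpa using H.mul_mem ha (hH.le hag)
  refine ⟨⟨⟨le_antisymm hcont.le_induced fun U hU => ?_⟩, hinj⟩, ?_⟩
  · obtain ⟨W, hW, hWU⟩ := isOpen_induced_iff.1 (hU.preimage QuotientGroup.continuous_mk)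
    refine isOpen_induced_iff.2 ⟨((↑) : G → G ⧸ Γ) '' W, QuotientGroup.isOpenMap_coe W hW, ?_⟩
    ext x
    induction x using QuotientGroup.induction_on with | _ a
    constructor
    · rintro ⟨w, hw, hwa⟩
      rw [fiberMap_mk] at hwa
      have hwH : w ∈ H := hpre w ⟨a, a.2, hwa.symm⟩
      have h1 : (⟨w, hwH⟩ : H) ∈ Subtype.val ⁻¹' W := hw
      rw [hWU] at h1
      have h2 : ((⟨w, hwH⟩ : H) : H ⧸ Γ.subgroupOf H) = a := hinj hwa
      rw [← h2]
      exact h1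
    · intro ha
      have h1 : a ∈ Subtype.val ⁻¹' W := by rw [hWU]; exact ha
      exact ⟨a, h1, rfl⟩
  · rw [hrange, ← (QuotientGroup.isQuotientMap_mk (N := Γ)).isClosed_preimage]
    convert hH.isClosed
    ext g
    exact ⟨hpre g, fun h => ⟨g, h, rfl⟩⟩

theorem compactSpace_fiber [CompactSpace (G ⧸ Γ)] (hH : IsVerticalSubgroup Γ H) :
    CompactSpace (H ⧸ Γ.subgroupOf H) :=
  hH.isClosedEmbedding_fiberMap.compactSpace

theorem t2Space_fiber (hH : IsVerticalSubgroup Γ H) : T2Space (H ⧸ Γ.subgroupOf H) := by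
  have := t2Space_quotient hH.isClosed_lattice
  exact hH.isClosedEmbedding_fiberMap.isEmbedding.t2Space

/-- Equivariant functions do not vanish identically at any point. -/
theorem exists_isEquivariant_ne_zero [CompactSpace (G ⧸ Γ)] (hH : IsVerticalSubgroup Γ H)
    (χ : H →ₜ* Circle) (hχ : ∀ h : H, (h : G) ∈ Γ → χ h = 1) (g₀ : G) :
    ∃ f : C(G ⧸ Γ, ℂ), IsEquivariant χ f ∧ f (g₀ : G ⧸ Γ) ≠ 0 := by
  have := hH.normal_subgroupOf
  have := hH.compactSpace_fiber
  have := hH.t2Space_fiber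
  have := t2Space_quotient hH.isClosed_lattice
  let K := H ⧸ Γ.subgroupOf H
  borelize K
  let μ : Measure K := Measure.haarMeasure ⊤
  have : IsProbabilityMeasure μ := ⟨by
    have := Measure.haarMeasure_self (K₀ := (⊤ : TopologicalSpace.PositiveCompacts K))
    simpa using this⟩
  let χK : K →* Circle := QuotientGroup.lift _ χ.toMonoidHom fun h hh => hχ h hh
  have hχK : Continuous χK := 
    (QuotientGroup.isQuotientMap_mk (N := Γ.subgroupOf H)).continuous_iff.2 χ.continuous_toFun
  have hχmk : ∀ h : H, χK (h : K) = χ h := fun h => rfl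
  -- The bump `F` is `1` at `g₀` and vanishes where the character has nonpositive real part on the
  -- fibre through `g₀`. The average of `F(g k) χ(k)⁻¹` over the fibre is equivariant, and at `g₀`
  -- its real part is the integral of a nonnegative function that is not identically zero.
  let S : Set (G ⧸ Γ) := (fun k => g₀ • fiberMap Γ H k) '' {k | ((χK k : Circle) : ℂ).re ≤ 0}
  have hfc := hH.isClosedEmbedding_fiberMap.continuous
  have hS : IsClosed S := by
    refine (IsCompact.image ?_ (hfc.const_smul g₀)).isClosed
    refine IsClosed.isCompact ?_
    exact isClosed_le (Complex.continuous_re.comp (continuous_induced_dom.comp hχK))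
      continuous_const
  have hg₀ : (g₀ : G ⧸ Γ) ∉ S := by
    rintro ⟨k, hk, hkg⟩
    have h1 : fiberMap Γ H k = fiberMap Γ H (1 : K) := by
      have : fiberMap Γ H (1 : K) = ((1 : G) : G ⧸ Γ) := rfl
      rw [this]
      apply MulAction.injective g₀
      dsimp only at hkg ⊢
      rw [hkg, MulAction.Quotient.smul_coe, smul_eq_mul, mul_one]
    have h2 := hH.isClosedEmbedding_fiberMap.injective h1
    rw [Set.mem_ofPred_eq, h2, map_one] at hk
    norm_num at hk
  obtain ⟨F, hF0, hF1, hF⟩ := exists_continuous_zero_one_of_isClosed hS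
    (isClosed_singleton (x := (g₀ : G ⧸ Γ))) (by simpa using hg₀)
  let Φ : C(G, C(K, ℂ)) := ContinuousMap.curry
    ⟨fun p : G × K => (F (p.1 • fiberMap Γ H p.2) : ℂ) * ((χK p.2)⁻¹ : Circle), by
      have h1 : Continuous fun p : G × K => ((((χK p.2)⁻¹ : Circle)) : ℂ) :=
        continuous_induced_dom.comp (hχK.comp continuous_snd).inv
      have h2 : Continuous fun p : G × K => fiberMap Γ H p.2 := hfc.comp continuous_snd
      fun_prop⟩
  have hΦ : ∀ g k, Φ g k = (F (g • fiberMap Γ H k) : ℂ) * ((χK k)⁻¹ : Circle) := fun _ _ => rfl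
  have hint : ∀ φ : C(K, ℂ), Integrable φ μ := fun φ =>
    φ.continuous.integrable_of_hasCompactSupport (HasCompactSupport.of_compactSpace _)
  let I : C(K, ℂ) →L[ℂ] ℂ := LinearMap.mkContinuous
    { toFun := fun φ => ∫ k, φ k ∂μ
      map_add' := fun φ ψ => integral_add (hint φ) (hint ψ)
      map_smul' := fun c φ => integral_smul c _ } 1 (fun φ => by
        refine (norm_integral_le_of_norm_le_const (C := ‖φ‖)
          (.of_forall fun k => φ.norm_coe_le_norm k)).trans ?_
        simp)
  let f₀ : G → ℂ := fun g => I (Φ g)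
  have hf₀ : Continuous f₀ := I.continuous.comp Φ.continuous
  have hI : ∀ g, f₀ g = ∫ k, (F (g • fiberMap Γ H k) : ℂ) * ((χK k)⁻¹ : Circle) ∂μ := fun g => rfl
  have hequiv : ∀ (g : G) (h : H), f₀ (g * h) = (χ h : ℂ) * f₀ g := by
    intro g h
    rw [hI, hI, ← integral_const_mul]
    refine Eq.trans ?_ (integral_mul_left_eq_self (μ := μ) (fun k => (χ h : ℂ) *
      ((F (g • fiberMap Γ H k) : ℂ) * ((χK k)⁻¹ : Circle))) ((h : K)))
    refine integral_congr_ae (.of_forall fun k => ?_)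
    dsimp only
    rw [map_mul, hχmk, mul_inv, Circle.coe_mul, mul_left_comm, ← mul_assoc (χ h : ℂ),
      ← Circle.coe_mul, mul_inv_cancel, Circle.coe_one, one_mul, mul_smul]
    congr 4
    induction k using QuotientGroup.induction_on with | _ a
    rfl
  let f : C(G ⧸ Γ, ℂ) := ⟨Quotient.lift f₀ fun a b hab => by
      replace hab : a⁻¹ * b ∈ Γ := QuotientGroup.leftRel_apply.1 hab
      have := hequiv a ⟨a⁻¹ * b, hH.le hab⟩
      rw [hχ _ hab, Circle.coe_one, one_mul] at this
      simpa using this.symm, hf₀.quotient_lift _⟩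
  refine ⟨f, hequiv, ?_⟩
  change f₀ g₀ ≠ 0
  intro h0
  have hre : (f₀ g₀).re = ∫ k, F (g₀ • fiberMap Γ H k) * ((χK k : Circle) : ℂ).re ∂μ := by
    refine (Complex.reCLM.integral_comp_comm (hint (Φ g₀))).symm.trans ?_
    refine integral_congr_ae (.of_forall fun k => ?_)
    simp [hΦ]
  have hpos : ∀ k, 0 ≤ F (g₀ • fiberMap Γ H k) * ((χK k : Circle) : ℂ).re := by
    intro k
    by_cases hk : ((χK k : Circle) : ℂ).re ≤ 0
    · have : F (g₀ • fiberMap Γ H k) = 0 := hF0 ⟨k, hk, rfl⟩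
      rw [this, zero_mul]
    · exact mul_nonneg (hF _).1 (not_le.1 hk).le
  have hcont : Continuous fun k => F (g₀ • fiberMap Γ H k) * ((χK k : Circle) : ℂ).re := by
    have h1 : Continuous fun k => ((χK k : Circle) : ℂ).re :=
      Complex.continuous_re.comp (continuous_induced_dom.comp hχK)
    fun_prop
  rw [h0, Complex.zero_re, eq_comm, integral_eq_zero_iff_of_nonneg hpos
    (hcont.integrable_of_hasCompactSupport (HasCompactSupport.of_compactSpace _))] at hre
  have h5 : _ = (0 : ℝ) := congrFun ((hcont.ae_eq_iff_eq μ continuous_const).1 hre) 1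
  have h6 : F (g₀ • fiberMap Γ H (1 : K)) = 1 := by
    have : g₀ • fiberMap Γ H (1 : K) = (g₀ : G ⧸ Γ) := by
      change ((g₀ * 1 : G) : G ⧸ Γ) = g₀
      rw [mul_one]
    rw [this]
    exact hF1 rfl
  rw [h6, map_one] at h5
  norm_num at h5

/-- Sums of equivariant functions are dense. -/
theorem exists_mem_span_isEquivariant_near [CompactSpace (G ⧸ Γ)] (hH : IsVerticalSubgroup Γ H)
    (f : C(G ⧸ Γ, ℂ)) {ε : ℝ} (hε : 0 < ε) :
    ∃ f' ∈ Submodule.span ℂ {f : C(G ⧸ Γ, ℂ) | ∃ χ : H →ₜ* Circle, IsEquivariant χ f},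
      ‖f - f'‖ < ε := by
  let S : Submonoid C(G ⧸ Γ, ℂ) :=
    { carrier := {f : C(G ⧸ Γ, ℂ) | ∃ χ : H →ₜ* Circle, IsEquivariant χ f}
      one_mem' := ⟨1, fun g h => by simp⟩
      mul_mem' := by
        rintro f f' ⟨χ, hχ⟩ ⟨χ', hχ'⟩
        refine ⟨χ * χ', fun g h => ?_⟩
        rw [ContinuousMap.mul_apply, hχ, hχ', ContinuousMap.mul_apply,
          ContinuousMonoidHom.mul_apply, Circle.coe_mul]
        ring }
  refine exists_mem_span_submonoid_near S ?_ ?_ f hε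
  · rintro f ⟨χ, hχ⟩
    refine ⟨χ⁻¹, fun g h => ?_⟩
    rw [ContinuousMap.star_apply, hχ, ContinuousMap.star_apply, star_mul', Complex.star_def,
      ← Circle.coe_inv_eq_conj]
    rfl
  · intro x y hxy
    induction x using QuotientGroup.induction_on with | _ a
    induction y using QuotientGroup.induction_on with | _ b
    -- In one fibre, a character of `H/Γ` distinguishes the two points, and so does an equivariant
    -- function that is nonzero at the first. Points of different fibres are separated by a function
    -- lifted from `G/H`, equivariant for the trivial character.
    by_cases hab : a⁻¹ * b ∈ H
    · have := hH.compactSpace_fiber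
      have := hH.t2Space_fiber
      have := hH.normal_subgroupOf
      let _ := hH.fiberCommGroup
      have htg : IsTopologicalGroup (H ⧸ Γ.subgroupOf H) := QuotientGroup.instIsTopologicalGroup _
      obtain ⟨χ, hχ⟩ := exists_character_ne_one
        (x₀ := ((⟨a⁻¹ * b, hab⟩ : H) : H ⧸ Γ.subgroupOf H)) (by
          intro h
          refine hxy (QuotientGroup.eq.2 ?_)
          exact (QuotientGroup.eq_one_iff (⟨a⁻¹ * b, hab⟩ : H)).1 h)
      let χ' : H →ₜ* Circle :=
        ⟨χ.toMonoidHom.comp (QuotientGroup.mk' (Γ.subgroupOf H)),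
          χ.continuous_toFun.comp QuotientGroup.continuous_mk⟩
      have hχ' : ∀ h : H, χ' h = χ (h : H ⧸ Γ.subgroupOf H) := fun _ => rfl
      obtain ⟨f, hf, hfa⟩ := hH.exists_isEquivariant_ne_zero χ' (fun h hh => by
        rw [hχ', (QuotientGroup.eq_one_iff h).2 hh, map_one]) a
      refine ⟨f, ⟨χ', hf⟩, fun h => hχ ?_⟩
      have h1 := hf a ⟨a⁻¹ * b, hab⟩
      rw [mul_inv_cancel_left, ← h, eq_comm, mul_eq_right₀ hfa] at h1
      rw [← hχ']
      exact Circle.ext h1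
    · have hbase := t2Space_quotient hH.isClosed
      have := hH.compactSpace_base
      obtain ⟨F, hF0, hF1, -⟩ := exists_continuous_zero_one_of_isClosed
        (isClosed_singleton (x := (a : G ⧸ H))) (isClosed_singleton (x := (b : G ⧸ H)))
        (by
          rw [Set.disjoint_singleton]
          intro h
          exact hab (QuotientGroup.eq.1 h))
      let q : G ⧸ Γ → G ⧸ H := Quotient.map' id fun a b hab => by
        rw [QuotientGroup.leftRel_apply] at hab ⊢; exact hH.le hab
      have hq : Continuous q := Continuous.quotient_map' continuous_id _
      refine ⟨⟨fun x => (F (q x) : ℂ), by fun_prop⟩, ⟨1, fun g h => ?_⟩, ?_⟩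
      · have : q ((g * h : G) : G ⧸ Γ) = q (g : G ⧸ Γ) := by
          change ((g * h : G) : G ⧸ H) = g
          rw [eq_comm, QuotientGroup.eq]
          simp
        simp [this]
      · have e0 : F (q (a : G ⧸ Γ)) = 0 := hF0 rfl
        have e1 : F (q (b : G ⧸ Γ)) = 1 := hF1 rfl
        simp [e0, e1]

end IsVerticalSubgroup

end Vertical

/-! ### The commutator pairing of a character -/

section Pairing

open scoped commutatorElement

/-- Central factors drop out of commutators, so commutators of elements of `ΓG₂` lie in `Γ`. As `Γ`
is discrete, hence closed, this persists on the closure. -/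
theorem isVerticalSubgroup_topologicalClosure {G : Type*} [Group G] [TopologicalSpace G]
    [IsTopologicalGroup G] [T2Space G] (h2 : commutator G ≤ Subgroup.center G) (Γ : Subgroup G)
    [DiscreteTopology Γ] : IsVerticalSubgroup Γ (Γ ⊔ commutator G).topologicalClosure where
  isClosed_lattice := Subgroup.isClosed_of_discrete
  isClosed := Subgroup.isClosed_topologicalClosure _
  le := le_sup_left.trans (Subgroup.le_topologicalClosure _)
  commutator_le := le_sup_right.trans (Subgroup.le_topologicalClosure _)
  commutator_mem := by
    intro h hh h' hh'
    have hcl : closure (Γ : Set G) = Γ := (Subgroup.isClosed_of_discrete (H := Γ)).closure_eq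
    have key : ⁅h, h'⁆ ∈ closure (Γ : Set G) := by
      refine map_mem_closure₂ (s := ((Γ ⊔ commutator G : Subgroup G) : Set G))
        (t := ((Γ ⊔ commutator G : Subgroup G) : Set G)) (f := fun a b : G => ⁅a, b⁆) ?_ hh hh' ?_
      · simp only [commutatorElement_def]
        fun_prop
      · intro a ha b hb
        have : (commutator G).Normal := inferInstance
        rw [Subgroup.mul_normal] at ha hb
        obtain ⟨γ, hγ, z, hz, rfl⟩ := ha
        obtain ⟨γ', hγ', z', hz', rfl⟩ := hb
        have e1 := Subgroup.mem_center_iff.1 (h2 hz)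
        have e2 := Subgroup.mem_center_iff.1 (h2 hz')
        have : ⁅γ * z, γ' * z'⁆ = ⁅γ, γ'⁆ := by
          simp only [commutatorElement_def, mul_inv_rev]
          calc γ * z * (γ' * z') * (z⁻¹ * γ⁻¹) * (z'⁻¹ * γ'⁻¹)
              = γ * (z * (γ' * z')) * z⁻¹ * γ⁻¹ * (z'⁻¹ * γ'⁻¹) := by group
            _ = γ * γ' * (z' * γ⁻¹) * z'⁻¹ * γ'⁻¹ := by rw [← e1 (γ' * z')]; group
            _ = γ * γ' * γ⁻¹ * γ'⁻¹ := by rw [← e2 γ⁻¹]; group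
        dsimp only
        rw [this, commutatorElement_def]
        exact Γ.mul_mem (Γ.mul_mem (Γ.mul_mem hγ hγ') (Γ.inv_mem hγ)) (Γ.inv_mem hγ')
    rwa [hcl] at key

variable {G : Type*} [Group G] [TopologicalSpace G] {Γ H : Subgroup G}

/-- The commutator pairing `(g, g') ↦ χ [g, g']` of a `2`-step nilpotent group. -/
noncomputable def pairing (h2 : commutator G ≤ Subgroup.center G) (hH : commutator G ≤ H)
    (χ : H →ₜ* Circle) : G →* G →* Circle :=
  have hz : ∀ a b c : G, c * ⁅a, b⁆ = ⁅a, b⁆ * c := fun a b c =>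
    Subgroup.mem_center_iff.1 (h2 (commutatorElement_mem_commutator a b)) c
  MonoidHom.mk' (fun g => MonoidHom.mk' (fun g' => χ ⟨⁅g, g'⁆, hH (commutatorElement_mem_commutator g g')⟩)
    (fun a b => by
      rw [← map_mul]
      congr 1
      ext
      change ⁅g, a * b⁆ = ⁅g, a⁆ * ⁅g, b⁆
      rw [commutatorElement_mul_right_eq_mul_conj, mul_assoc, mul_assoc, ← mul_assoc a, hz,
        mul_assoc, mul_inv_cancel, mul_one]))
    (fun a b => by
      ext1 g
      change χ _ = χ _ * χ _
      rw [← map_mul]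
      congr 1
      ext
      change ⁅a * b, g⁆ = ⁅a, g⁆ * ⁅b, g⁆
      rw [commutatorElement_mul_left_eq_conj_mul, hz b g a, mul_assoc ⁅b, g⁆ a, mul_inv_cancel,
        mul_one, hz a g])

variable (h2 : commutator G ≤ Subgroup.center G) (hH : commutator G ≤ H) (χ : H →ₜ* Circle)

theorem pairing_apply (g g' : G) :
    pairing h2 hH χ g g' = χ ⟨⁅g, g'⁆, hH (commutatorElement_mem_commutator g g')⟩ := rfl

theorem pairing_self (g : G) : pairing h2 hH χ g g = 1 := by
  rw [pairing_apply]
  convert map_one χ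
  exact commutatorElement_self g

theorem pairing_swap (g g' : G) : pairing h2 hH χ g' g = (pairing h2 hH χ g g')⁻¹ := by
  rw [pairing_apply, pairing_apply, ← map_inv]
  congr 1
  ext
  exact (commutatorElement_inv g g').symm

/-- The commutator is formed inside `H`, and a homomorphism to an abelian group kills it. The
integrality conditions on the model lattice come from this. -/
theorem pairing_of_mem {h h' : G} (hh : h ∈ H) (hh' : h' ∈ H) : pairing h2 hH χ h h' = 1 := by
  rw [pairing_apply]
  have : (⟨⁅h, h'⁆, hH (commutatorElement_mem_commutator h h')⟩ : H) =
      ⟨h, hh⟩ * ⟨h', hh'⟩ * ⟨h, hh⟩⁻¹ * ⟨h', hh'⟩⁻¹ := rfl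
  rw [this, map_mul, map_mul, map_mul, map_inv, map_inv, mul_right_comm (χ _), mul_inv_cancel,
    one_mul, mul_inv_cancel]

theorem continuous_pairing [IsTopologicalGroup G] :
    Continuous fun p : G × G => pairing h2 hH χ p.1 p.2 := by
  simp only [pairing_apply]
  refine χ.continuous_toFun.comp (Continuous.subtype_mk ?_ _)
  simp only [commutatorElement_def]
  fun_prop

/-- `τ^n u = [τ^n,u] u τ^n` with a central commutator, on which `f` transforms by `χ`, and
bilinearity extracts the power `n`. This phase, unbounded in `n`, is what the comparison with a
model has to cancel. -/
theorem IsEquivariant.zpow_smul_smul {χ : H →ₜ* Circle} {f : C(G ⧸ Γ, ℂ)}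
    (hf : IsEquivariant χ f) (τ u : G) (n : ℤ) (x : G ⧸ Γ) :
    f (τ ^ n • u • x) = ((pairing h2 hH χ τ u ^ n : Circle) : ℂ) * f (u • τ ^ n • x) := by
  induction x using QuotientGroup.induction_on with | _ g
  rw [← MonoidHom.zpow_apply, ← map_zpow, pairing_apply]
  refine Eq.trans ?_ (hf (u * (τ ^ n * g))
    ⟨⁅τ ^ n, u⁆, hH (commutatorElement_mem_commutator (τ ^ n) u)⟩)
  have hz := Subgroup.mem_center_iff.1 (h2 (commutatorElement_mem_commutator (τ ^ n) u))
  change f ((τ ^ n * (u * g) : G) : G ⧸ Γ) = f ((u * (τ ^ n * g) * ⁅τ ^ n, u⁆ : G) : G ⧸ Γ)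
  rw [hz, commutatorElement_def]
  congr 2
  group

/-- Elements of `H` close to the identity pair trivially with all of `G`. -/
theorem exists_nhds_pairing_eq_one [IsTopologicalGroup G] [CompactSpace (G ⧸ Γ)] (hΓ : Γ ≤ H) :
    ∃ U ∈ 𝓝 (1 : G), ∀ h ∈ U, h ∈ H → ∀ g, pairing h2 hH χ h g = 1 := by
  set B := pairing h2 hH χ with hB
  have hV : IsOpen (Circle.centeredArc (Real.pi / 2)) := Circle.isOpen_centeredArc _
  have h1V : (1 : Circle) ∈ Circle.centeredArc (Real.pi / 2) := by
    rw [Circle.mem_centeredArc (by linarith [Real.pi_pos])]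
    simp [Real.pi_pos]
  -- For `h ∈ H` the value `B h g` depends only on `gΓ`, so compactness gives a neighbourhood of `1`
  -- that works for all `g`. The homomorphism `g ↦ B h g` then takes values in an open half circle,
  -- which contains no nontrivial subgroup.
  have hloc : ∀ x : G ⧸ Γ, ∃ U ∈ 𝓝 (1 : G), ∃ W ∈ 𝓝 x, ∀ h ∈ U, h ∈ H → ∀ g : G,
      (g : G ⧸ Γ) ∈ W → B h g ∈ Circle.centeredArc (Real.pi / 2) := by
    intro x
    induction x using QuotientGroup.induction_on with | _ g
    have h1 : (fun p : G × G => B p.1 p.2) ⁻¹' Circle.centeredArc (Real.pi / 2) ∈ 𝓝 ((1 : G), g) := by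
      refine (continuous_pairing h2 hH χ).continuousAt.preimage_mem_nhds (hV.mem_nhds ?_)
      change B 1 g ∈ _
      rwa [map_one, MonoidHom.one_apply]
    obtain ⟨U, hU, W, hW, hUW⟩ := mem_nhds_prod_iff.1 h1
    refine ⟨U, hU, ((↑) : G → G ⧸ Γ) '' W, QuotientGroup.isOpenMap_coe.image_mem_nhds hW, ?_⟩
    rintro h hh hhH g' ⟨w, hw, hwg⟩
    have h2 : B h w ∈ Circle.centeredArc (Real.pi / 2) := hUW (Set.mk_mem_prod hh hw)
    have h3 : g' = w * (w⁻¹ * g') := by group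
    rw [h3, map_mul, pairing_of_mem _ hH χ hhH (hΓ (QuotientGroup.eq.1 hwg)), mul_one]
    exact h2
  choose U hU W hW hUW using hloc
  obtain ⟨t, ht⟩ := CompactSpace.elim_nhds_subcover W hW
  refine ⟨⋂ x ∈ t, U x, (Filter.biInter_finset_mem t).2 fun x _ => hU x, fun h hh hhH g => ?_⟩
  have hall : ∀ g, B h g ∈ Circle.centeredArc (Real.pi / 2) := by
    intro g
    have : (g : G ⧸ Γ) ∈ ⋃ x ∈ t, W x := by rw [ht]; trivial
    obtain ⟨x, hx, hg⟩ := Set.mem_iUnion₂.1 this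
    exact hUW x h (Set.mem_iInter₂.1 hh x hx) hhH g hg
  refine Circle.eq_one_of_forall_pow_mem_centeredArc_pi_div_two fun n _ => ?_
  rw [← map_pow]
  exact hall (g ^ n)

end Pairing

/-! ### Heisenberg-type groups and their elementary nilsystems -/

section Heisenberg

open scoped commutatorElement

variable {V : Type} [NormedAddCommGroup V] [NormedSpace ℝ V]

/-- The central extension of a real vector space `V` by the circle attached to a bilinear form. -/
def Heis (_ : V →L[ℝ] V →L[ℝ] ℝ) : Type := V × Circle

namespace Heis

variable (β : V →L[ℝ] V →L[ℝ] ℝ)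

noncomputable instance : TopologicalSpace (Heis β) := inferInstanceAs (TopologicalSpace (V × Circle))

instance : T2Space (Heis β) := inferInstanceAs (T2Space (V × Circle))

noncomputable instance :
    ChartedSpace (ModelProd V (EuclideanSpace ℝ (Fin 1))) (Heis β) :=
  inferInstanceAs (ChartedSpace (ModelProd V (EuclideanSpace ℝ (Fin 1))) (V × Circle))

/-- The element of `Heis β` with the given components. -/
def mk (v : V) (z : Circle) : Heis β := (v, z)

variable {β}

/-- The vector component. -/
def fst (p : Heis β) : V := Prod.fst p

/-- The circle component. -/
def snd (p : Heis β) : Circle := Prod.snd p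

@[ext] theorem ext {p q : Heis β} (h1 : p.fst = q.fst) (h2 : p.snd = q.snd) : p = q :=
  Prod.ext h1 h2

@[simp] theorem fst_mk (v : V) (z : Circle) : (mk β v z).fst = v := rfl

@[simp] theorem snd_mk (v : V) (z : Circle) : (mk β v z).snd = z := rfl

theorem continuous_fst : Continuous (fst : Heis β → V) := _root_.continuous_fst

theorem continuous_snd : Continuous (snd : Heis β → Circle) := _root_.continuous_snd

theorem continuous_mk : Continuous fun q : V × Circle => mk β q.1 q.2 := continuous_id

noncomputable instance : Group (Heis β) where
  mul p q := mk β (p.fst + q.fst) (p.snd * q.snd * Real.fourierChar (β p.fst q.fst))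
  one := mk β 0 1
  inv p := mk β (-p.fst) (p.snd⁻¹ * Real.fourierChar (β p.fst p.fst))
  mul_assoc p q r := by
    ext1
    · exact add_assoc _ _ _
    · change p.snd * q.snd * Real.fourierChar (β p.fst q.fst) * r.snd *
          Real.fourierChar (β (p.fst + q.fst) r.fst) =
        p.snd * (q.snd * r.snd * Real.fourierChar (β q.fst r.fst)) *
          Real.fourierChar (β p.fst (q.fst + r.fst))
      simp only [map_add, _root_.add_apply, AddChar.map_add_eq_mul]
      ac_rfl
  one_mul p := by
    ext1
    · exact zero_add _
    · change 1 * p.snd * Real.fourierChar (β 0 p.fst) = p.snd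
      simp
  mul_one p := by
    ext1
    · exact add_zero _
    · change p.snd * 1 * Real.fourierChar (β p.fst 0) = p.snd
      simp
  inv_mul_cancel p := by
    ext1
    · exact neg_add_cancel _
    · change p.snd⁻¹ * Real.fourierChar (β p.fst p.fst) * p.snd *
        Real.fourierChar (β (-p.fst) p.fst) = 1
      rw [map_neg, _root_.neg_apply, AddChar.map_neg_eq_inv]
      rw [mul_right_comm p.snd⁻¹, inv_mul_cancel, one_mul, mul_inv_cancel]

@[simp] theorem fst_mul (p q : Heis β) : (p * q).fst = p.fst + q.fst := rfl

@[simp] theorem snd_mul (p q : Heis β) :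
    (p * q).snd = p.snd * q.snd * Real.fourierChar (β p.fst q.fst) := rfl

@[simp] theorem fst_one : (1 : Heis β).fst = 0 := rfl

@[simp] theorem snd_one : (1 : Heis β).snd = 1 := rfl

@[simp] theorem fst_inv (p : Heis β) : (p⁻¹).fst = -p.fst := rfl

@[simp] theorem snd_inv (p : Heis β) :
    (p⁻¹).snd = p.snd⁻¹ * Real.fourierChar (β p.fst p.fst) := rfl

theorem fst_zpow (p : Heis β) (n : ℤ) : (p ^ n).fst = n • p.fst := by
  let F : Heis β →* Multiplicative V :=
    { toFun := fun p => Multiplicative.ofAdd p.fst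
      map_one' := rfl
      map_mul' := fun _ _ => rfl }
  exact congrArg Multiplicative.toAdd (map_zpow F p n)

theorem commutatorElement_eq (p q : Heis β) :
    ⁅p, q⁆ = mk β 0 (Real.fourierChar (β p.fst q.fst - β q.fst p.fst)) := by
  have key : p * q = mk β 0 (Real.fourierChar (β p.fst q.fst - β q.fst p.fst)) * (q * p) := by
    ext1
    · simp [add_comm]
    · simp only [snd_mul, snd_mk, fst_mul, fst_mk, map_zero, _root_.zero_apply,
        AddChar.map_zero_eq_one, mul_one]
      rw [sub_eq_add_neg, AddChar.map_add_eq_mul, AddChar.map_neg_eq_inv, mul_comm q.snd]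
      have : (Real.fourierChar (β q.fst p.fst))⁻¹ * Real.fourierChar (β q.fst p.fst) = 1 :=
        inv_mul_cancel _
      calc p.snd * q.snd * Real.fourierChar (β p.fst q.fst)
          = p.snd * q.snd * Real.fourierChar (β p.fst q.fst) *
            ((Real.fourierChar (β q.fst p.fst))⁻¹ * Real.fourierChar (β q.fst p.fst)) := by
            rw [this, mul_one]
        _ = _ := by ac_rfl
  rw [commutatorElement_def, key]
  group

theorem mk_zero_comm (z : Circle) (p : Heis β) : p * mk β 0 z = mk β 0 z * p := by
  ext1 <;> simp [mul_comm]

variable (β) in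
/-- The elements with trivial vector component. -/
noncomputable def centralCircle : Subgroup (Heis β) where
  carrier := {p | p.fst = 0}
  one_mem' := rfl
  mul_mem' := by
    intro p q hp hq
    rw [Set.mem_ofPred_eq] at hp hq ⊢
    rw [fst_mul, hp, hq, add_zero]
  inv_mem' := by
    intro p hp
    rw [Set.mem_ofPred_eq] at hp ⊢
    rw [fst_inv, hp, neg_zero]

theorem mem_centralCircle {p : Heis β} : p ∈ centralCircle β ↔ p.fst = 0 := Iff.rfl

theorem commutator_le_centralCircle : commutator (Heis β) ≤ centralCircle β := by
  rw [commutator_def, Subgroup.commutator_le]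
  intro p _ q _
  rw [commutatorElement_eq]
  rfl

theorem commutator_le_center : commutator (Heis β) ≤ Subgroup.center (Heis β) := by
  intro p hp
  have h0 : p.fst = 0 := commutator_le_centralCircle hp
  have : p = mk β 0 p.snd := Heis.ext h0 rfl
  rw [Subgroup.mem_center_iff, this]
  exact mk_zero_comm _

/-- One noncommuting pair is enough: rescaling `v` makes the commutator phase run through the whole
circle. -/
theorem centralCircle_le_commutator (hnd : ∃ v w, β v w ≠ β w v) :
    centralCircle β ≤ commutator (Heis β) := by
  intro p hp
  obtain ⟨v, w, hvw⟩ := hnd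
  obtain ⟨t, ht⟩ := Circle.exp_surjective p.snd
  set c := β v w - β w v with hc
  have hc0 : c ≠ 0 := sub_ne_zero.2 hvw
  have : p = ⁅mk β ((t / (2 * Real.pi) / c) • v) 1, mk β w 1⁆ := by
    rw [commutatorElement_eq]
    refine Heis.ext hp ?_
    rw [snd_mk, fst_mk, fst_mk, map_smul, map_smul, _root_.smul_apply, ← smul_sub,
      ← hc, smul_eq_mul, div_mul_cancel₀ _ hc0, Real.fourierChar_apply', ← ht]
    congr 1
    field_simp
  rw [this]
  exact commutatorElement_mem_commutator _ _

instance : IsManifold (𝓘(ℝ, V).prod (𝓡 1)) ∞ (Heis β) :=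
  inferInstanceAs (IsManifold (𝓘(ℝ, V).prod (𝓡 1)) ∞ (V × Circle))

instance : LieGroup (𝓘(ℝ, V).prod (𝓡 1)) ∞ (Heis β) where
  contMDiff_mul := by
    have h1 : ContMDiff ((𝓘(ℝ, V).prod (𝓡 1)).prod (𝓘(ℝ, V).prod (𝓡 1))) 𝓘(ℝ, V) ∞
        (fun p : (V × Circle) × (V × Circle) => p.1.1) := contMDiff_fst.fst
    have h2 : ContMDiff ((𝓘(ℝ, V).prod (𝓡 1)).prod (𝓘(ℝ, V).prod (𝓡 1))) 𝓘(ℝ, V) ∞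
        (fun p : (V × Circle) × (V × Circle) => p.2.1) := contMDiff_snd.fst
    have h3 : ContMDiff ((𝓘(ℝ, V).prod (𝓡 1)).prod (𝓘(ℝ, V).prod (𝓡 1))) (𝓡 1) ∞
        (fun p : (V × Circle) × (V × Circle) => p.1.2) := contMDiff_fst.snd
    have h4 : ContMDiff ((𝓘(ℝ, V).prod (𝓡 1)).prod (𝓘(ℝ, V).prod (𝓡 1))) (𝓡 1) ∞
        (fun p : (V × Circle) × (V × Circle) => p.2.2) := contMDiff_snd.snd
    have hβ : ContDiff ℝ ∞ fun q : V × V => 2 * Real.pi * β q.1 q.2 :=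
      contDiff_const.mul β.isBoundedBilinearMap.contDiff
    have h5 : ContMDiff ((𝓘(ℝ, V).prod (𝓡 1)).prod (𝓘(ℝ, V).prod (𝓡 1))) (𝓡 1) ∞
        (fun p : (V × Circle) × (V × Circle) => Circle.exp (2 * Real.pi * β p.1.1 p.2.1)) :=
      contMDiff_circleExp.comp (hβ.contMDiff.comp (h1.prodMk_space h2))
    exact (h1.add h2).prodMk ((h3.mul h4).mul h5)
  contMDiff_inv := by
    have h1 : ContMDiff (𝓘(ℝ, V).prod (𝓡 1)) 𝓘(ℝ, V) ∞ (fun p : V × Circle => p.1) :=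
      contMDiff_fst
    have h3 : ContMDiff (𝓘(ℝ, V).prod (𝓡 1)) (𝓡 1) ∞ (fun p : V × Circle => p.2) :=
      contMDiff_snd
    have hβ : ContDiff ℝ ∞ fun q : V => 2 * Real.pi * β q q :=
      contDiff_const.mul (β.isBoundedBilinearMap.contDiff.comp (contDiff_id.prodMk contDiff_id))
    have h5 : ContMDiff (𝓘(ℝ, V).prod (𝓡 1)) (𝓡 1) ∞
        (fun p : V × Circle => Circle.exp (2 * Real.pi * β p.1 p.1)) :=
      contMDiff_circleExp.comp (hβ.contMDiff.comp h1)
    exact h1.neg.prodMk (h3.inv.mul h5)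

theorem isRealLieGroup [FiniteDimensional ℝ V] : IsRealLieGroup (Heis β) :=
  ⟨inferInstance, V × EuclideanSpace ℝ (Fin 1), inferInstance, inferInstance, inferInstance,
    ModelProd V (EuclideanSpace ℝ (Fin 1)), inferInstance, 𝓘(ℝ, V).prod (𝓡 1), inferInstance,
    inferInstance, inferInstance⟩

instance : IsTopologicalGroup (Heis β) :=
  topologicalGroup_of_lieGroup (𝓘(ℝ, V).prod (𝓡 1)) ∞

variable (β) in
/-- The elements whose vector component lies in `Λ`. -/
noncomputable def vertical (Λ : AddSubgroup V) : Subgroup (Heis β) where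
  carrier := {p | p.fst ∈ Λ}
  one_mem' := Λ.zero_mem
  mul_mem' := Λ.add_mem
  inv_mem' := Λ.neg_mem

theorem mem_vertical {Λ : AddSubgroup V} {p : Heis β} : p ∈ vertical β Λ ↔ p.fst ∈ Λ := Iff.rfl

theorem commutator_le_vertical (Λ : AddSubgroup V) : commutator (Heis β) ≤ vertical β Λ :=
  commutator_le_centralCircle.trans fun p hp => by
    rw [mem_vertical, mem_centralCircle.1 hp]; exact Λ.zero_mem

/-- Over an isotropic discrete subgroup the extension by the circle splits. -/
theorem exists_splitting (Λ : AddSubgroup V) [DiscreteTopology Λ]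
    (hΛ : ∀ v ∈ Λ, ∀ w ∈ Λ, ∃ n : ℤ, β v w - β w v = n) :
    ∃ ρ : vertical β Λ →ₜ* Circle, ∀ p : vertical β Λ, (p : Heis β).fst = 0 →
      ρ p = (p : Heis β).snd := by
  let HM := vertical β Λ
  have hcomm : ∀ p q : HM, p * q = q * p := by
    intro p q
    ext1
    change (p : Heis β) * q = q * p
    rw [← commutatorElement_eq_one_iff_mul_comm, commutatorElement_eq]
    obtain ⟨n, hn⟩ := hΛ _ p.2 _ q.2
    rw [hn]
    ext1
    · rfl
    · rw [snd_mk, Real.fourierChar_apply', snd_one, mul_comm, Circle.exp_int_mul_two_pi]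
  let _ : CommGroup HM := { (inferInstance : Group HM) with mul_comm := hcomm }
  let ι : Circle →* HM :=
    { toFun := fun z => ⟨mk β 0 z, Λ.zero_mem⟩
      map_one' := rfl
      map_mul' := fun z w => by
        ext1
        change mk β 0 (z * w) = mk β 0 z * mk β 0 w
        ext1 <;> simp }
  have hι : Function.Injective ι := fun z w h => congrArg (fun p : HM => (p : Heis β).snd) h
  -- Isotropy makes the group above `Λ` commutative. The circle is divisible, hence injective among
  -- abelian groups, so the identity of the central circle extends to a retraction.
  let _ : DivisibleBy (Additive Circle) ℤ :=
    Function.Surjective.divisibleBy (f := fun t : ℝ => Additive.ofMul (Circle.exp t))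
      (fun z => by
        obtain ⟨t, ht⟩ := Circle.exp_surjective z.toMul
        exact ⟨t, congrArg Additive.ofMul ht⟩)
      (fun t n => map_zsmul Circle.expHom n t)
  obtain ⟨r, hr⟩ := (Module.Baer.of_divisible (Additive Circle)).extension_property_addMonoidHom
    (MonoidHom.toAdditive ι) hι (AddMonoidHom.id _)
  let ρ : HM →* Circle := MonoidHom.toAdditive.symm r
  have hρι : ∀ z, ρ (ι z) = z := fun z => DFunLike.congr_fun hr (Additive.ofMul z)
  have hρ : ∀ p : HM, (p : Heis β).fst = 0 → ρ p = (p : Heis β).snd := by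
    intro p hp
    have : p = ι (p : Heis β).snd := Subtype.ext (Heis.ext hp rfl)
    conv_lhs => rw [this]
    exact hρι _
  refine ⟨⟨ρ, ?_⟩, hρ⟩
  refine continuous_of_continuousAt_one ρ ?_
  -- Continuity of the algebraically chosen retraction: since `Λ` is discrete, near the identity
  -- only central elements occur, and there the retraction is the circle component.
  have hev : ∀ᶠ p : HM in 𝓝 1, (p : Heis β).fst = 0 := by
    have h1 : Continuous fun p : HM => (⟨(p : Heis β).fst, p.2⟩ : Λ) :=
      (continuous_fst.comp continuous_subtype_val).subtype_mk _
    have h2 : (fun p : HM => (⟨(p : Heis β).fst, p.2⟩ : Λ)) ⁻¹' {0} ∈ 𝓝 (1 : HM) := by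
      refine h1.continuousAt.preimage_mem_nhds ((isOpen_discrete _).mem_nhds ?_)
      exact Subtype.ext (fst_one (β := β))
    filter_upwards [h2] with p hp
    exact congrArg Subtype.val hp
  refine ContinuousAt.congr ?_ (hev.mono fun p hp => (hρ p hp).symm)
  exact (continuous_snd.comp continuous_subtype_val).continuousAt

/-- The lattice in `Heis β` attached to a splitting over `Λ`. -/
noncomputable def lattice {Λ : AddSubgroup V} (ρ : vertical β Λ →ₜ* Circle) : Subgroup (Heis β) :=
  (ρ.toMonoidHom.ker).map (vertical β Λ).subtype

theorem mem_lattice {Λ : AddSubgroup V} {ρ : vertical β Λ →ₜ* Circle} {p : Heis β} :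
    p ∈ lattice ρ ↔ ∃ h : p ∈ vertical β Λ, ρ ⟨p, h⟩ = 1 := by
  constructor
  · rintro ⟨q, hq, rfl⟩
    exact ⟨q.2, hq⟩
  · rintro ⟨h, hp⟩
    exact ⟨⟨p, h⟩, hp, rfl⟩

section Lattice

variable {Λ : AddSubgroup V} {ρ : vertical β Λ →ₜ* Circle}

theorem discreteTopology_lattice [DiscreteTopology Λ]
    (hρ : ∀ p : vertical β Λ, (p : Heis β).fst = 0 → ρ p = (p : Heis β).snd) :
    DiscreteTopology (lattice ρ) := by
  refine discreteTopology_of_isOpen_singleton_one ?_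
  have hmem : ∀ p : lattice ρ, (p : Heis β).fst ∈ Λ := fun p => (mem_lattice.1 p.2).1
  have h1 : Continuous fun p : lattice ρ => (⟨(p : Heis β).fst, hmem p⟩ : Λ) :=
    (continuous_fst.comp continuous_subtype_val).subtype_mk _
  convert (isOpen_discrete ({0} : Set Λ)).preimage h1
  ext p
  constructor
  · rintro rfl
    exact Subtype.ext (fst_one (β := β))
  · intro hp
    have h0 : (p : Heis β).fst = 0 := congrArg Subtype.val hp
    obtain ⟨h, hp1⟩ := mem_lattice.1 p.2
    rw [hρ _ h0] at hp1
    exact Subtype.ext (Heis.ext h0 hp1)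

theorem isVerticalSubgroup [DiscreteTopology Λ]
    (hΛ : ∀ v ∈ Λ, ∀ w ∈ Λ, ∃ n : ℤ, β v w - β w v = n)
    (hρ : ∀ p : vertical β Λ, (p : Heis β).fst = 0 → ρ p = (p : Heis β).snd) :
    IsVerticalSubgroup (lattice ρ) (vertical β Λ) where
  isClosed_lattice := by
    have := discreteTopology_lattice hρ
    exact Subgroup.isClosed_of_discrete
  isClosed := (AddSubgroup.isClosed_of_discrete (H := Λ)).preimage continuous_fst
  le := fun p hp => (mem_lattice.1 hp).1
  commutator_le := commutator_le_vertical Λ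
  commutator_mem := by
    intro p hp q hq
    rw [commutatorElement_eq]
    obtain ⟨n, hn⟩ := hΛ _ hp _ hq
    rw [hn, Real.fourierChar_apply', mul_comm, Circle.exp_int_mul_two_pi]
    exact (lattice ρ).one_mem

theorem compactSpace_quotient
    (hρ : ∀ p : vertical β Λ, (p : Heis β).fst = 0 → ρ p = (p : Heis β).snd)
    (hΛ : ∃ K : Set V, IsCompact K ∧ ∀ v, ∃ k ∈ K, v - k ∈ Λ) :
    CompactSpace (Heis β ⧸ lattice ρ) := by
  obtain ⟨K, hK, hKΛ⟩ := hΛ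
  have h1 : Continuous fun q : V × Circle => ((mk β q.1 q.2 : Heis β) : Heis β ⧸ lattice ρ) :=
    QuotientGroup.continuous_mk.comp continuous_mk
  refine ⟨?_⟩
  have : (Set.univ : Set (Heis β ⧸ lattice ρ)) =
      (fun q : V × Circle => ((mk β q.1 q.2 : Heis β) : Heis β ⧸ lattice ρ)) '' K ×ˢ Set.univ := by
    symm
    rw [Set.eq_univ_iff_forall]
    intro x
    induction x using QuotientGroup.induction_on with | _ p
    obtain ⟨k, hk, hpk⟩ := hKΛ p.fst
    let l : Heis β := (mk β k 1)⁻¹ * p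
    have hl : l ∈ vertical β Λ := by
      rw [mem_vertical]
      change -k + p.fst ∈ Λ
      rwa [neg_add_eq_sub]
    -- `l` lies above `Λ`; dividing it by the central element of phase `ρ l` brings it into the
    -- kernel of `ρ`. Hence `K × Circle` maps onto the quotient.
    let z : Circle := ρ ⟨l, hl⟩
    refine ⟨(k, z), ⟨hk, trivial⟩, ?_⟩
    dsimp only
    rw [QuotientGroup.eq, mem_lattice]
    have e1 : mk β k z = mk β k 1 * mk β 0 z := by ext1 <;> simp
    have e2 : (mk β k z)⁻¹ * p = (mk β 0 z)⁻¹ * l := by rw [e1, mul_inv_rev, mul_assoc]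
    have h0 : mk β 0 z ∈ vertical β Λ := Λ.zero_mem
    have hmem : (mk β 0 z)⁻¹ * l ∈ vertical β Λ := Subgroup.mul_mem _ (Subgroup.inv_mem _ h0) hl
    rw [e2]
    refine ⟨hmem, ?_⟩
    have e3 : (⟨(mk β 0 z)⁻¹ * l, hmem⟩ : vertical β Λ) = ⟨mk β 0 z, h0⟩⁻¹ * ⟨l, hl⟩ := rfl
    rw [e3, map_mul, map_inv, hρ ⟨mk β 0 z, h0⟩ rfl]
    exact inv_mul_cancel z
  rw [this]
  exact (hK.prod isCompact_univ).image h1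

theorem pairing_eq (hρ : ∀ p : vertical β Λ, (p : Heis β).fst = 0 → ρ p = (p : Heis β).snd)
    (p q : Heis β) :
    pairing commutator_le_center (commutator_le_vertical Λ) ρ p q =
      Real.fourierChar (β p.fst q.fst - β q.fst p.fst) := by
  rw [pairing_apply, hρ]
  · change (⁅p, q⁆ : Heis β).snd = _
    rw [commutatorElement_eq, snd_mk]
  · change (⁅p, q⁆ : Heis β).fst = _
    rw [commutatorElement_eq, fst_mk]

/-- The elementary nilsystem attached to a splitting. -/
noncomputable def nilsystem [FiniteDimensional ℝ V] [DiscreteTopology Λ]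
    (hρ : ∀ p : vertical β Λ, (p : Heis β).fst = 0 → ρ p = (p : Heis β).snd)
    (hΛ : ∃ K : Set V, IsCompact K ∧ ∀ v, ∃ k ∈ K, v - k ∈ Λ)
    (hnd : ∃ v w, β v w ≠ β w v) (τ : Heis β) : ElementaryNilsystem where
  G := Heis β
  isLie := isRealLieGroup
  twoStep := commutator_le_center
  Γ := lattice ρ
  discrete := discreteTopology_lattice hρ
  cocompact := compactSpace_quotient hρ hΛ
  τ := τ
  circleIso :=
    { toFun := fun p => (p : Heis β).snd
      invFun := fun z => ⟨mk β 0 z, centralCircle_le_commutator hnd rfl⟩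
      left_inv := fun p =>
        Subtype.ext (Heis.ext (commutator_le_centralCircle p.2).symm rfl)
      right_inv := fun z => rfl
      map_mul' := fun p q => by
        have h0 : (p : Heis β).fst = 0 := commutator_le_centralCircle p.2
        change (p : Heis β).snd * (q : Heis β).snd *
          Real.fourierChar (β (p : Heis β).fst (q : Heis β).fst) = _
        rw [h0]
        simp
      continuous_toFun := continuous_snd.comp continuous_subtype_val
      continuous_invFun :=
        (continuous_mk.comp (Continuous.prodMk_right (0 : V))).subtype_mk _ }

/-- Equivariant functions give basic elementary nilsequences, also after multiplication by an
exponential sequence. -/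
theorem mul_mem_basicElementaryNilsequences [FiniteDimensional ℝ V] [DiscreteTopology Λ]
    (hρ : ∀ p : vertical β Λ, (p : Heis β).fst = 0 → ρ p = (p : Heis β).snd)
    (hΛ : ∃ K : Set V, IsCompact K ∧ ∀ v, ∃ k ∈ K, v - k ∈ Λ)
    (hnd : ∃ v w, β v w ≠ β w v) {f : C(Heis β ⧸ lattice ρ, ℂ)} (hf : IsEquivariant ρ f)
    (τ : Heis β) (x : Heis β ⧸ lattice ρ) (z : Circle) :
    (expSeq z * fun n : ℤ => f (τ ^ n • x)) ∈ basicElementaryNilsequences := by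
  have hact : ∀ (w : Circle) (y : Heis β ⧸ lattice ρ), f (mk β 0 w • y) = (w : ℂ) * f y := by
    intro w y
    induction y using QuotientGroup.induction_on with | _ g
    have h0 : mk β 0 w ∈ vertical β Λ := Λ.zero_mem
    have h1 := hf g ⟨mk β 0 w, h0⟩
    rw [hρ _ rfl, mk_zero_comm] at h1
    exact h1
  -- The factor `z ^ n` is absorbed by multiplying `τ` by the central element of phase `z`; the
  -- lattice and the function are unchanged.
  refine ⟨nilsystem hρ hΛ hnd (τ * mk β 0 z), f, x, ?_, ?_⟩
  · suffices key : ∀ (u : commutator (Heis β)) (y : Heis β ⧸ lattice ρ),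
        f ((u : Heis β) • y) = ((u : Heis β).snd : ℂ) * f y from key
    intro u y
    have h0 : (u : Heis β).fst = 0 := commutator_le_centralCircle u.2
    have h1 : (u : Heis β) = mk β 0 (u : Heis β).snd := Heis.ext h0 rfl
    have h2 := hact (u : Heis β).snd y
    rw [← h1] at h2
    exact h2
  · funext n
    have hpow : ∀ n : ℤ, (mk β 0 z) ^ n = mk β 0 (z ^ n) := by
      let ι : Circle →* Heis β :=
        { toFun := fun z => mk β 0 z
          map_one' := rfl
          map_mul' := fun z w => by ext1 <;> simp }
      exact fun n => (map_zpow ι z n).symm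
    have hc : Commute τ (mk β 0 z) := mk_zero_comm z τ
    change ((z ^ n : Circle) : ℂ) * f (τ ^ n • x) = f ((τ * mk β 0 z) ^ n • x)
    rw [hc.mul_zpow, hpow, mk_zero_comm, mul_smul, hact]

end Lattice

end Heis

end Heisenberg

/-! ### Bohr sets and the model lattice -/

section Bohr

variable {ι : Type} [Fintype ι]

/-- The representatives in `[-1/2, 1/2]` of the coordinates of `m • θ` modulo `1`. -/
noncomputable def bohr (θ : ι → ℝ) (m : ℤ) : ι → ℝ := fun i => m * θ i - round (m * θ i)

omit [Fintype ι] in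
theorem bohr_apply (θ : ι → ℝ) (m : ℤ) (i : ι) :
    bohr θ m i = m * θ i - round (m * θ i) := rfl

/-- Two representatives, one of size at most `1/2` and the other strictly below, differ by an
integer of absolute value below `1`. Local additivity of Bohr coordinates reduces to this
uniqueness. -/
theorem bohr_eq {θ : ι → ℝ} {m : ℤ} {y : ι → ℝ} (hy : ‖y‖ < 1 / 2)
    (h : ∀ i, ∃ j : ℤ, y i = m * θ i - j) : bohr θ m = y := by
  funext i
  obtain ⟨j, hj⟩ := h i
  have h1 := abs_le.1 (abs_sub_round (m * θ i))
  have h2 := abs_lt.1 ((Real.norm_eq_abs _ ▸ norm_le_pi_norm y i).trans_lt hy)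
  have h3 : ((round (m * θ i) - j : ℤ) : ℝ) < 1 := by push_cast; linarith
  have h4 : (-1 : ℝ) < ((round (m * θ i) - j : ℤ) : ℝ) := by push_cast; linarith
  have h5 : round (m * θ i) - j < 1 := by exact_mod_cast h3
  have h6 : -1 < round (m * θ i) - j := by exact_mod_cast h4
  have h7 : round (m * θ i) = j := by omega
  rw [hj, bohr_apply, h7]

theorem bohr_add {θ : ι → ℝ} {m m' : ℤ} (h : ‖bohr θ m + bohr θ m'‖ < 1 / 2) :
    bohr θ (m + m') = bohr θ m + bohr θ m' :=
  bohr_eq h fun i => ⟨round (m * θ i) + round (m' * θ i), by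
    rw [Pi.add_apply, bohr_apply, bohr_apply]; push_cast; ring⟩

theorem bohr_sub {θ : ι → ℝ} {m m' : ℤ} (h : ‖bohr θ m - bohr θ m'‖ < 1 / 2) :
    bohr θ (m - m') = bohr θ m - bohr θ m' :=
  bohr_eq h fun i => ⟨round (m * θ i) - round (m' * θ i), by
    rw [Pi.sub_apply, bohr_apply, bohr_apply]; push_cast; ring⟩

omit [Fintype ι] in
theorem bohr_zero (θ : ι → ℝ) : bohr θ 0 = 0 := by
  funext i; simp [bohr_apply]

theorem locallyAdditive_bohr {θ : ι → ℝ} {δ : ℝ} (hδ : δ ≤ 1 / 2) {f : ℤ → ℝ}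
    (hf : ∀ m m', ‖bohr θ m‖ < δ → ‖bohr θ m'‖ < δ → ‖bohr θ (m + m')‖ < δ →
      f (m + m') = f m + f m') : LocallyAdditive (bohr θ) δ f where
  map_zero := bohr_zero θ
  map_neg m hm := by
    have := bohr_sub (θ := θ) (m := 0) (m' := m)
      (by rw [bohr_zero, zero_sub, norm_neg]; exact hm.trans_le hδ)
    rwa [zero_sub, bohr_zero, zero_sub] at this
  map_add m m' _ _ h := bohr_add (h.trans_le hδ)
  add m m' hm hm' h := hf m m' hm hm' (by rwa [bohr_add (h.trans_le hδ)])

/-- Bohr sets are syndetic. -/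
theorem exists_bohr_near (θ : ι → ℝ) {δ : ℝ} (hδ : 0 < δ) (hδ' : δ ≤ 1 / 2) :
    ∃ L : ℝ, ∀ n : ℤ, ∃ m : ℤ, ‖bohr θ m‖ < δ ∧ |(n : ℝ) - m| ≤ L := by
  classical
  -- Pigeonhole: the cube is cut into boxes of side `δ / 2`, finitely many of which are visited.
  -- Subtracting from `n` a fixed time with the same box lands in the Bohr set at bounded distance
  -- from `n`.
  let box : ℤ → ι → ℤ := fun n i => ⌊bohr θ n i / (δ / 2)⌋
  have hfin : (Set.range box).Finite := by
    refine (Set.finite_Icc (fun _ => ⌊-(1 / 2) / (δ / 2)⌋) (fun _ => ⌊(1 / 2) / (δ / 2)⌋)).subset ?_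
    rintro _ ⟨n, rfl⟩
    have hb : ∀ i, |bohr θ n i| ≤ 1 / 2 := fun i => abs_sub_round _
    refine ⟨fun i => Int.floor_le_floor ?_, fun i => Int.floor_le_floor ?_⟩
    · have := (abs_le.1 (hb i)).1
      gcongr
    · have := (abs_le.1 (hb i)).2
      gcongr
  let rep : (ι → ℤ) → ℤ := fun q => if h : ∃ n, box n = q then h.choose else 0
  have hrep : ∀ n, box (rep (box n)) = box n := fun n => by
    have h : ∃ n', box n' = box n := ⟨n, rfl⟩
    simp only [rep, dif_pos h]
    exact h.choose_spec
  obtain ⟨L, hL⟩ := (hfin.image fun q => |(rep q : ℝ)|).bddAbove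
  refine ⟨L, fun n => ⟨n - rep (box n), ?_, ?_⟩⟩
  · have hle : ‖bohr θ n - bohr θ (rep (box n))‖ ≤ δ / 2 := by
      refine (pi_norm_le_iff_of_nonneg (by positivity)).2 fun i => ?_
      have h1 : ⌊bohr θ (rep (box n)) i / (δ / 2)⌋ = ⌊bohr θ n i / (δ / 2)⌋ :=
        congrFun (hrep n) i
      have h2 := (Int.abs_sub_lt_one_of_floor_eq_floor h1.symm).le
      rw [← sub_div, abs_div, abs_of_pos (half_pos hδ), div_le_one (half_pos hδ)] at h2
      exact h2
    rw [bohr_sub (by linarith)]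
    linarith
  · have : |(rep (box n) : ℝ)| ≤ L := hL ⟨box n, ⟨n, rfl⟩, rfl⟩
    push_cast
    rwa [sub_sub_cancel]

-- `φ` carries the pairing of small elements with the translation and `Φ` their pairing with one
-- another; the factor `1/2` compensates for antisymmetrisation. The last coordinate adds a
-- Heisenberg plane, so that commutators fill the circle even when `φ` and `Φ` vanish.
omit [Fintype ι] in
theorem exists_bilinear_prod {E : Type*} [NormedAddCommGroup E] [NormedSpace ℝ E]
    (Y : Submodule ℝ E) [FiniteDimensional ℝ Y] (φ : E →ₗ[ℝ] ℝ) (Φ : E →ₗ[ℝ] E →ₗ[ℝ] ℝ) :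
    ∃ β : (ℝ × Y × ℝ) →L[ℝ] (ℝ × Y × ℝ) →L[ℝ] ℝ, ∀ v w,
      β v w = v.1 * (φ w.2.1 + w.2.2) + 1 / 2 * Φ v.2.1 w.2.1 := by
  let B₀ : (ℝ × Y × ℝ) →ₗ[ℝ] (ℝ × Y × ℝ) →ₗ[ℝ] ℝ := LinearMap.mk₂ ℝ
    (fun v w => v.1 * (φ w.2.1 + w.2.2) + 1 / 2 * Φ v.2.1 w.2.1)
    (fun v v' w => by simp; ring) (fun c v w => by simp; ring)
    (fun v w w' => by simp; ring) (fun c v w => by simp; ring)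
  exact ⟨LinearMap.toContinuousLinearMap
    ((LinearMap.toContinuousLinearMap (𝕜 := ℝ) (E := ℝ × Y × ℝ) (F' := ℝ)).toLinearMap ∘ₗ B₀),
    fun _ _ => rfl⟩

/-- The isotropic lattice attached to integral local data on a Bohr set. -/
theorem exists_isotropic_lattice (θ : ι → ℝ) {δ : ℝ} (hδ : 0 < δ) (hδ2 : δ ≤ 1 / 2) {ℓ : ℤ → ℝ}
    {b : ℤ → ℤ → ℝ} (hℓ : LocallyAdditive (bohr θ) δ ℓ) (hℓ1 : ∀ m, ‖bohr θ m‖ < δ → |ℓ m| ≤ 1)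
    (hb1 : ∀ m m', ‖bohr θ m‖ < δ → ‖bohr θ m'‖ < δ → |b m m'| ≤ 1)
    (hb₁ : ∀ m', ‖bohr θ m'‖ < δ → LocallyAdditive (bohr θ) δ fun m => b m m')
    (hb₂ : ∀ m, ‖bohr θ m‖ < δ → LocallyAdditive (bohr θ) δ (b m))
    (hanti : ∀ m m', ‖bohr θ m‖ < δ → ‖bohr θ m'‖ < δ → b m' m = -b m m')
    (hint : ∀ m m', ‖bohr θ m‖ < δ → ‖bohr θ m'‖ < δ →
      ∃ n : ℤ, b m m' + m' * ℓ m - m * ℓ m' = n) :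
    ∃ (V : Type) (_ : NormedAddCommGroup V) (_ : NormedSpace ℝ V) (_ : FiniteDimensional ℝ V)
      (β : V →L[ℝ] V →L[ℝ] ℝ) (Λ : AddSubgroup V) (e : V),
      DiscreteTopology Λ ∧ (∀ v ∈ Λ, ∀ w ∈ Λ, ∃ n : ℤ, β v w - β w v = n) ∧
      (∃ K : Set V, IsCompact K ∧ ∀ v, ∃ k ∈ K, v - k ∈ Λ) ∧ (∃ v w, β v w ≠ β w v) ∧
      ∃ ε > 0, ∀ (m : ℤ) (v : V), ‖v‖ < ε → v - m • e ∈ Λ →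
        ‖bohr θ m‖ < δ ∧ β e v - β v e = ℓ m := by
  classical
  let E := ι → ℝ
  obtain ⟨δ', hδ'0, hδ'⟩ : ∃ δ' > 0, (Module.finrank ℝ E + 1) * δ' < δ := by
    refine ⟨δ / 2 / (Module.finrank ℝ E + 1), by positivity, ?_⟩
    rw [mul_div_cancel₀ _ (by positivity)]
    linarith
  have hδ'δ : δ' < δ := by
    have h0 : (0 : ℝ) ≤ Module.finrank ℝ E := Nat.cast_nonneg _
    nlinarith
  obtain ⟨φ, hφ⟩ := hℓ.exists_linear hδ hℓ1 hδ'
  obtain ⟨Φ, hΦ⟩ := LocallyAdditive.exists_bilinear hδ hb1 hb₁ hb₂ hδ'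
  let Y : Submodule ℝ E := Submodule.span ℝ (bohr θ '' {m | ‖bohr θ m‖ < δ'})
  have hY : ∀ {m}, ‖bohr θ m‖ < δ' → bohr θ m ∈ Y := fun {m} hm =>
    Submodule.subset_span ⟨m, hm, rfl⟩
  let V := ℝ × Y × ℝ
  obtain ⟨β, hβ⟩ := exists_bilinear_prod Y φ Φ
  -- The sign of the middle coordinate makes `m • e` congruent modulo the lattice to the small
  -- vector `(0, bohr θ m, 0)`, where `e = (1, 0, 0)`.
  let S : Set V := {v | ∃ (m k : ℤ) (hm : ‖bohr θ m‖ < δ'), v = ((m : ℝ), -⟨bohr θ m, hY hm⟩, (k : ℝ))}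
  let Λ : AddSubgroup V := AddSubgroup.closure S
  have hS : ∀ (m k : ℤ) (hm : ‖bohr θ m‖ < δ'),
      (((m : ℝ), -⟨bohr θ m, hY hm⟩, (k : ℝ)) : V) ∈ Λ := fun m k hm =>
    AddSubgroup.subset_closure ⟨m, k, hm, rfl⟩
  have hΛ : ∀ v ∈ Λ, ∃ m k : ℤ, v.1 = m ∧ v.2.2 = k ∧
      ∀ i, ∃ j : ℤ, (v.2.1 : E) i = -(m * θ i) - j := by
    intro v hv
    induction hv using AddSubgroup.closure_induction with
    | mem v hv =>
      obtain ⟨m, k, hm, rfl⟩ := hv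
      refine ⟨m, k, rfl, rfl, fun i => ⟨-round (m * θ i), ?_⟩⟩
      change -(m * θ i - round (m * θ i)) = _
      push_cast; ring
    | zero => exact ⟨0, 0, by simp, by simp, fun i => ⟨0, by change (0 : ℝ) = _; simp⟩⟩
    | add v w _ _ hv hw =>
      obtain ⟨m, k, h1, h2, h3⟩ := hv
      obtain ⟨m', k', h1', h2', h3'⟩ := hw
      refine ⟨m + m', k + k', ?_, ?_, fun i => ?_⟩
      · change v.1 + w.1 = _
        rw [h1, h1', Int.cast_add]
      · change v.2.2 + w.2.2 = _
        rw [h2, h2', Int.cast_add]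
      obtain ⟨j, hj⟩ := h3 i
      obtain ⟨j', hj'⟩ := h3' i
      refine ⟨j + j', ?_⟩
      change (v.2.1 : E) i + (w.2.1 : E) i = _
      rw [hj, hj']; push_cast; ring
    | neg v _ hv =>
      obtain ⟨m, k, h1, h2, h3⟩ := hv
      refine ⟨-m, -k, ?_, ?_, fun i => ?_⟩
      · change -v.1 = _
        rw [h1, Int.cast_neg]
      · change -v.2.2 = _
        rw [h2, Int.cast_neg]
      obtain ⟨j, hj⟩ := h3 i
      refine ⟨-j, ?_⟩
      change -((v.2.1 : E) i) = _
      rw [hj]; push_cast; ring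
  have hintzero : ∀ n : ℤ, |(n : ℝ)| < 1 → n = 0 := fun n hn => by
    have : |n| < 1 := by exact_mod_cast hn
    exact Int.abs_lt_one_iff.1 this
  have hnorm1 : ∀ v : V, |v.1| ≤ ‖v‖ := fun v => norm_fst_le v
  have hnorm2 : ∀ v : V, ‖(v.2.1 : E)‖ ≤ ‖v‖ := fun v =>
    (norm_fst_le v.2).trans (norm_snd_le v)
  have hnorm3 : ∀ v : V, |v.2.2| ≤ ‖v‖ := fun v => (norm_snd_le v.2).trans (norm_snd_le v)
  refine ⟨V, inferInstance, inferInstance, inferInstance, β, Λ, (1, 0, 0), ?_, ?_, ?_, ?_, ?_⟩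
  · refine discreteTopology_of_isOpen_singleton_zero ?_
    convert (Metric.isOpen_ball (x := (0 : V)) (ε := 1)).preimage
      (continuous_subtype_val (p := fun v => v ∈ Λ))
    ext ⟨v, hv⟩
    constructor
    · intro h
      rw [Set.mem_singleton_iff] at h
      simp [h]
    · intro h
      have hlt : ‖v‖ < 1 := by simpa using h
      obtain ⟨m, k, h1, h2, h3⟩ := hΛ v hv
      have hm : m = 0 := hintzero m (by rw [← h1]; exact (hnorm1 v).trans_lt hlt)
      have hk : k = 0 := hintzero k (by rw [← h2]; exact (hnorm3 v).trans_lt hlt)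
      have hy : v.2.1 = 0 := by
        ext i
        obtain ⟨j, hj⟩ := h3 i
        rw [hm, Int.cast_zero, zero_mul, neg_zero, zero_sub] at hj
        have : |(j : ℝ)| < 1 := by
          rw [← abs_neg, ← hj]
          exact ((norm_le_pi_norm (v.2.1 : E) i).trans (hnorm2 v)).trans_lt hlt
        rw [hj, hintzero j this, Int.cast_zero, neg_zero]
        rfl
      rw [Set.mem_singleton_iff]
      ext1
      refine Prod.ext (by simp [h1, hm]) (Prod.ext hy (by simp [h2, hk]))
  · let Ω : V →L[ℝ] V →L[ℝ] ℝ := β - β.flip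
    have hΩ : ∀ v w, Ω v w = β v w - β w v := fun _ _ => rfl
    let Zr : AddSubgroup ℝ := (Int.castAddHom ℝ).range
    -- On generators `Ω` equals `b m m' + m' * ℓ m - m * ℓ m' + m * k' - m' * k`, an integer by
    -- `hint`. Additivity in each slot then extends integrality to `Λ`.
    have hgen : ∀ v ∈ S, ∀ w ∈ S, Ω v w ∈ Zr := by
      rintro _ ⟨m, k, hm, rfl⟩ _ ⟨m', k', hm', rfl⟩
      obtain ⟨n, hn⟩ := hint m m' (hm.trans hδ'δ) (hm'.trans hδ'δ)
      refine ⟨n + m * k' - m' * k, ?_⟩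
      have ha := hanti m m' (hm.trans hδ'δ) (hm'.trans hδ'δ)
      have e : Ω ((m : ℝ), -⟨bohr θ m, hY hm⟩, (k : ℝ)) ((m' : ℝ), -⟨bohr θ m', hY hm'⟩, (k' : ℝ)) =
          (m : ℝ) * (-ℓ m' + k') + 1 / 2 * b m m' - (m' * (-ℓ m + k) + 1 / 2 * b m' m) := by
        rw [hΩ, hβ, hβ, hφ m hm, hφ m' hm', hΦ m m' hm hm', hΦ m' m hm' hm]
        simp
      rw [e, ha]
      simp only [Int.coe_castAddHom]
      push_cast
      rw [← hn]; ring
    have hgen2 : ∀ v ∈ S, ∀ w ∈ Λ, Ω v w ∈ Zr := by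
      intro v hv w hw
      have : Λ ≤ Zr.comap (Ω v : V →+ ℝ) :=
        (AddSubgroup.closure_le _).2 fun w hw => hgen v hv w hw
      exact this hw
    intro v hv w hw
    have : Λ ≤ Zr.comap (Ω.flip w : V →+ ℝ) :=
      (AddSubgroup.closure_le _).2 fun v hv => hgen2 v hv w hw
    obtain ⟨n, hn⟩ := this hv
    exact ⟨n, hn.symm⟩
  -- Cocompactness: integer parts in a basis of Bohr vectors reduce the middle coordinate. A
  -- generator whose time lies within `L` of the resulting first coordinate reduces that one, at the
  -- cost of a small middle term. The last coordinate is reduced to its fractional part.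
  · obtain ⟨s, _, a, hli, ha, hxa, hcard, hspan⟩ := LocallyAdditive.exists_basis (bohr θ) δ'
    obtain ⟨L, hL⟩ := exists_bohr_near θ hδ'0 (hδ'δ.le.trans hδ2)
    let R : ℝ := max (L + 1) (max ((Fintype.card s + 1) * δ') 1)
    refine ⟨Metric.closedBall 0 R, isCompact_closedBall 0 R, fun v => ?_⟩
    have hYs : (v.2.1 : E) ∈ Submodule.span ℝ s := by
      have : Y ≤ Submodule.span ℝ s := Submodule.span_le.2 (by
        rintro _ ⟨m, hm, rfl⟩; exact hspan m hm)
      exact this v.2.1.2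
    rw [← Subtype.range_coe (s := s), Submodule.mem_span_range_iff_exists_fun] at hYs
    obtain ⟨c, hc⟩ := hYs
    let g : s → V := fun w => ((a w : ℝ), -⟨bohr θ (a w), hY (ha w)⟩, ((0 : ℤ) : ℝ))
    let l₁ : V := ∑ w, (-⌊c w⌋) • g w
    have hl₁ : l₁ ∈ Λ := Λ.sum_mem fun w _ => Λ.zsmul_mem (hS _ _ (ha w)) _
    obtain ⟨m, hm, hmL⟩ := hL ⌊v.1 - l₁.1⌋
    let l₂ : V := ((m : ℝ), -⟨bohr θ m, hY hm⟩, (⌊v.2.2⌋ : ℝ))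
    have hl₂ : l₂ ∈ Λ := hS _ _ hm
    refine ⟨v - (l₁ + l₂), ?_, by rw [sub_sub_cancel]; exact Λ.add_mem hl₁ hl₂⟩
    have hl₁2 : (l₁.2.1 : E) = ∑ w, (⌊c w⌋ : ℝ) • (w : E) := by
      have : (l₁.2.1 : E) = ∑ w, ((((-⌊c w⌋) • g w : V).2.1 : Y) : E) :=
        map_sum (Y.subtype.toAddMonoidHom.comp
          ((AddMonoidHom.fst Y ℝ).comp (AddMonoidHom.snd ℝ (Y × ℝ)))) _ _
      rw [this]
      refine Finset.sum_congr rfl fun w _ => ?_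
      have : ((((-⌊c w⌋) • g w : V).2.1 : Y) : E) = (-⌊c w⌋) • (-bohr θ (a w)) := rfl
      rw [this, hxa, neg_smul, smul_neg, neg_neg, Int.cast_smul_eq_zsmul]
    have hl₁3 : l₁.2.2 = 0 := by
      have : l₁.2.2 = ∑ w, ((-⌊c w⌋) • g w : V).2.2 :=
        map_sum ((AddMonoidHom.snd Y ℝ).comp (AddMonoidHom.snd ℝ (Y × ℝ))) _ _
      rw [this]
      refine Finset.sum_eq_zero fun w _ => ?_
      have : ((-⌊c w⌋) • g w : V).2.2 = (-⌊c w⌋) • ((0 : ℤ) : ℝ) := rfl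
      rw [this]; simp
    rw [mem_closedBall_zero_iff, Prod.norm_def, Prod.norm_def]
    refine max_le ?_ (max_le ?_ ?_)
    · refine le_trans ?_ (le_max_left _ _)
      have h1 := Int.fract_nonneg (v.1 - l₁.1)
      have h2 := (Int.fract_lt_one (v.1 - l₁.1)).le
      have h3 : (v - (l₁ + l₂)).1 = (⌊v.1 - l₁.1⌋ - m : ℝ) + Int.fract (v.1 - l₁.1) := by
        rw [add_comm (_ - _), ← add_sub_assoc, Int.fract_add_floor]
        change v.1 - (l₁.1 + m) = _
        ring
      rw [h3]
      refine (norm_add_le _ _).trans (add_le_add hmL ?_)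
      rwa [Real.norm_of_nonneg h1]
    · refine le_trans ?_ ((le_max_left _ _).trans (le_max_right _ _))
      have h3 : ((v - (l₁ + l₂)).2.1 : E) = ∑ w, Int.fract (c w) • (w : E) + bohr θ m := by
        change (v.2.1 : E) - ((l₁.2.1 : E) + -bohr θ m) = _
        rw [hl₁2, ← hc]
        simp only [Int.fract, sub_smul, Finset.sum_sub_distrib]
        abel
      change ‖((v - (l₁ + l₂)).2.1 : E)‖ ≤ _
      rw [h3]
      have h4 : ‖∑ w, Int.fract (c w) • (w : E)‖ ≤ Fintype.card s * δ' := by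
        refine (norm_sum_le _ _).trans ?_
        rw [← nsmul_eq_mul]
        refine Finset.sum_le_card_nsmul _ _ _ fun w _ => ?_
        rw [norm_smul, Real.norm_of_nonneg (Int.fract_nonneg _)]
        have h5 : ‖(w : E)‖ ≤ δ' := by rw [← hxa w]; exact (ha w).le
        have h6 := (Int.fract_lt_one (c w)).le
        exact (mul_le_of_le_one_left (norm_nonneg _) h6).trans h5
      refine (norm_add_le _ _).trans ?_
      rw [add_mul, one_mul]
      exact add_le_add h4 hm.le
    · refine le_trans ?_ ((le_max_right _ _).trans (le_max_right _ _))
      have h3 : (v - (l₁ + l₂)).2.2 = Int.fract v.2.2 := by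
        change v.2.2 - (l₁.2.2 + ⌊v.2.2⌋) = _
        rw [hl₁3, zero_add]; rfl
      rw [h3, Real.norm_of_nonneg (Int.fract_nonneg _)]
      exact (Int.fract_lt_one _).le
  · refine ⟨(1, 0, 0), (0, 0, 1), ?_⟩
    rw [hβ, hβ]
    simp
  -- The bound `1` forces the integers governing the outer coordinates to vanish, so `v = (0, bohr θ
  -- m, 0)`; the bound `δ'` puts `m` where `φ` computes `ℓ m`.
  · refine ⟨min δ' 1, by positivity, fun m v hv hmem => ?_⟩
    obtain ⟨m', k, h1, h2, h3⟩ := hΛ _ hmem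
    have hv1 : ‖v‖ < 1 := hv.trans_le (min_le_right _ _)
    have hvδ : ‖v‖ < δ' := hv.trans_le (min_le_left _ _)
    have e1 : v.1 - m = m' := by
      rw [← h1]
      change _ = v.1 - (m • ((1, 0, 0) : V)).1
      simp
    have e2 : v.2.2 = k := by
      rw [← h2]
      change _ = v.2.2 - (m • ((1, 0, 0) : V)).2.2
      simp
    have e3 : ((v - m • ((1, 0, 0) : V)).2.1 : E) = v.2.1 := by
      change (v.2.1 : E) - ((m • (0 : Y) : Y) : E) = _
      rw [smul_zero, Submodule.coe_zero, sub_zero]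
    have hs : m' + m = 0 := hintzero _ (by
      push_cast
      rw [← e1, sub_add_cancel]
      exact (hnorm1 v).trans_lt hv1)
    have hk : k = 0 := hintzero k (by rw [← e2]; exact (hnorm3 v).trans_lt hv1)
    have hm' : m' = -m := by omega
    have hx : bohr θ m = v.2.1 := by
      refine bohr_eq (((hnorm2 v).trans_lt hvδ).trans (hδ'δ.trans_le hδ2)) fun i => ?_
      obtain ⟨j, hj⟩ := h3 i
      refine ⟨j, ?_⟩
      rw [e3] at hj
      rw [hj, hm']; push_cast; ring
    have hsmall : ‖bohr θ m‖ < δ' := by rw [hx]; exact (hnorm2 v).trans_lt hvδ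
    refine ⟨hsmall.trans hδ'δ, ?_⟩
    have hv0 : v.1 = 0 := by
      have : ((m' + m : ℤ) : ℝ) = 0 := by rw [hs]; simp
      push_cast at this
      linarith
    rw [hφ m hsmall, hβ, hβ, hx, e2, hk, hv0]
    simp

end Bohr

/-! ### Local data of a translation and the comparison model -/

section LocalData

open Real (fourierChar)

/-- The representative in `(-1/2, 1/2]` of the logarithm of a point of the circle. -/
noncomputable def turn (z : Circle) : ℝ := (z : ℂ).arg / (2 * Real.pi)

theorem fourierChar_turn (z : Circle) : fourierChar (turn z) = z := by
  rw [Real.fourierChar_apply', turn, mul_div_cancel₀ _ Real.two_pi_pos.ne', Circle.exp_arg]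

theorem turn_fourierChar {s : ℝ} (hs : |s| < 1 / 2) : turn (fourierChar s) = s := by
  have h := abs_lt.1 hs
  have hp := Real.pi_pos
  rw [Real.fourierChar_apply', turn, Circle.arg_exp (by nlinarith) (by nlinarith),
    mul_div_cancel_left₀ _ Real.two_pi_pos.ne']

theorem turn_one : turn 1 = 0 := by simp [turn]

theorem turn_mul {z w : Circle} (hz : |turn z| < 1 / 8) (hw : |turn w| < 1 / 8) :
    turn (z * w) = turn z + turn w := by
  conv_lhs => rw [← fourierChar_turn z, ← fourierChar_turn w, ← AddChar.map_add_eq_mul]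
  exact turn_fourierChar ((abs_add_le _ _).trans_lt (by linarith))

theorem turn_inv {z : Circle} (hz : |turn z| < 1 / 8) : turn z⁻¹ = -turn z := by
  conv_lhs => rw [← fourierChar_turn z, ← AddChar.map_neg_eq_inv]
  exact turn_fourierChar (by rw [abs_neg]; linarith)

theorem continuousAt_turn_one : ContinuousAt turn 1 := by
  have h : ContinuousAt (fun z : Circle => (z : ℂ).arg) 1 :=
    ContinuousAt.comp (f := fun z : Circle => (z : ℂ)) (g := Complex.arg)
      (Complex.continuousAt_arg (by simp)) (continuous_induced_dom (f := fun z : Circle => (z : ℂ))).continuousAt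
  exact h.div_const _

theorem exists_int_of_fourierChar_eq_one {s : ℝ} (h : fourierChar s = 1) : ∃ n : ℤ, s = n := by
  rw [Real.fourierChar_apply', Circle.exp_eq_one] at h
  obtain ⟨n, hn⟩ := h
  exact ⟨n, by nlinarith [mul_left_cancel₀ Real.two_pi_pos.ne' (hn.trans (mul_comm _ _))]⟩

theorem half_le_re_fourierChar {s : ℝ} (hs : |s| < 1 / 8) :
    1 / 2 ≤ (fourierChar s : ℂ).re := by
  have hp := Real.pi_pos
  rw [Real.fourierChar_apply, Complex.exp_ofReal_mul_I_re, ← Real.cos_pi_div_three,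
    ← Real.cos_abs (2 * Real.pi * s)]
  have h : |2 * Real.pi * s| ≤ Real.pi / 3 := by
    rw [abs_mul, abs_of_pos Real.two_pi_pos]
    nlinarith
  exact Real.cos_le_cos_of_nonneg_of_le_pi (abs_nonneg _) (by linarith) h

/-- Bohr sets are small in any compact abelian group. -/
theorem exists_bohr_subset_nhds {K : Type} [CommGroup K] [TopologicalSpace K]
    [IsTopologicalGroup K] [CompactSpace K] [T2Space K] (α : K) {W : Set K} (hW : W ∈ 𝓝 1) :
    ∃ (ι : Type) (_ : Fintype ι) (θ : ι → ℝ), ∀ m : ℤ, ‖bohr θ m‖ < 1 / 8 → α ^ m ∈ W := by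
  classical
  -- Powers of a nontrivial point of the circle leave the open right half, so some power of a
  -- character separating `a` from `1` has nonpositive real part at `a`. Times in the Bohr set keep
  -- the real part at least `1/2`, because `cos (2πs) ≥ 1/2` for `|s| < 1/8`; thus `α ^ m` avoids a
  -- neighbourhood of each such `a`.
  have hχ : ∀ a : K, ∃ χ : K →ₜ* Circle, a ∈ interior W ∨ (χ a : ℂ).re ≤ 0 := by
    intro a
    by_cases ha : a ∈ interior W
    · exact ⟨1, Or.inl ha⟩
    have ha1 : a ≠ 1 := fun h => ha (h ▸ mem_interior_iff_mem_nhds.2 hW)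
    obtain ⟨χ, hχ⟩ := exists_character_ne_one ha1
    obtain ⟨n, hn⟩ : ∃ n : ℕ, χ a ^ n ∉ Circle.centeredArc (Real.pi / 2) := by
      by_contra! h
      exact hχ (Circle.eq_one_of_forall_pow_mem_centeredArc_pi_div_two fun n _ => h n)
    refine ⟨χ ^ n, Or.inr ?_⟩
    rw [Circle.mem_centeredArc (by linarith [Real.pi_pos]), Complex.abs_arg_lt_pi_div_two_iff] at hn
    push Not at hn
    rw [ContinuousMonoidHom.pow_apply]
    exact hn.1
  choose χ hχ using hχ
  let N : K → Set K := fun a =>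
    if a ∈ interior W then interior W else {x | (χ a x : ℂ).re < 1 / 2}
  have hN : ∀ a, N a ∈ 𝓝 a := by
    intro a
    by_cases ha : a ∈ interior W
    · simp only [N, if_pos ha]
      exact isOpen_interior.mem_nhds ha
    · simp only [N, if_neg ha]
      have hc : Continuous fun x => (χ a x : ℂ).re :=
        Complex.continuous_re.comp ((continuous_induced_dom (f := fun z : Circle => (z : ℂ))).comp (χ a).continuous_toFun)
      refine (isOpen_lt hc continuous_const).mem_nhds ?_
      exact ((hχ a).resolve_left ha).trans_lt (by norm_num)
  obtain ⟨t, ht⟩ := CompactSpace.elim_nhds_subcover N hN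
  refine ⟨t, inferInstance, fun a => turn (χ a α), fun m hm => ?_⟩
  have hmem : α ^ m ∈ ⋃ x ∈ t, N x := by rw [ht]; trivial
  obtain ⟨a, hat, ha⟩ := Set.mem_iUnion₂.1 hmem
  by_cases haW : a ∈ interior W
  · simp only [N, if_pos haW] at ha
    exact interior_subset ha
  · simp only [N, if_neg haW, Set.mem_ofPred_eq] at ha
    have h1 : χ a (α ^ m) = fourierChar (bohr (fun a : t => turn (χ a α)) m ⟨a, hat⟩) := by
      rw [bohr_apply, AddChar.map_sub_eq_div, map_zpow]
      conv_lhs => rw [← fourierChar_turn (χ a α), ← AddChar.map_zsmul_eq_zpow]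
      have h2 : ∀ k : ℤ, fourierChar (k : ℝ) = 1 := fun k => by
        rw [Real.fourierChar_apply', Circle.exp_eq_one]
        exact ⟨k, mul_comm _ _⟩
      rw [h2, div_one, zsmul_eq_mul]
    have h3 := half_le_re_fourierChar ((norm_le_pi_norm _ (⟨a, hat⟩ : t)).trans_lt hm)
    rw [← h1] at h3
    exact absurd ha (not_lt.2 h3)

variable {G : Type} [Group G] [TopologicalSpace G] [IsTopologicalGroup G] {Γ H : Subgroup G}
  [CompactSpace (G ⧸ Γ)]

/-- The commutator pairing of a translation of a `2`-step nilmanifold is, near the identity,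
that of a translation of a Heisenberg-type model. -/
theorem exists_model (hH : IsVerticalSubgroup Γ H) (h2 : commutator G ≤ Subgroup.center G)
    (χ : H →ₜ* Circle) (τ : G) :
    ∃ (V : Type) (_ : NormedAddCommGroup V) (_ : NormedSpace ℝ V) (_ : FiniteDimensional ℝ V)
      (β : V →L[ℝ] V →L[ℝ] ℝ) (Λ : AddSubgroup V) (e : V),
      DiscreteTopology Λ ∧ (∀ v ∈ Λ, ∀ w ∈ Λ, ∃ n : ℤ, β v w - β w v = n) ∧
      (∃ K : Set V, IsCompact K ∧ ∀ v, ∃ k ∈ K, v - k ∈ Λ) ∧ (∃ v w, β v w ≠ β w v) ∧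
      ∃ ε > 0, ∃ U ∈ 𝓝 (1 : G), ∀ (m : ℤ) (u : G) (v : V), u ∈ U → ‖v‖ < ε →
        (τ ^ m)⁻¹ * u ∈ H → v - m • e ∈ Λ →
        pairing h2 hH.commutator_le χ τ u = fourierChar (β e v - β v e) := by
  have hnormal := hH.normal
  let _ : CommGroup (G ⧸ H) := hH.baseCommGroup
  have : IsTopologicalGroup (G ⧸ H) :=
    (inferInstance : @IsTopologicalGroup (G ⧸ H) _ (QuotientGroup.Quotient.group H))
  have : CompactSpace (G ⧸ H) := hH.compactSpace_base
  have : T2Space (G ⧸ H) := t2Space_quotient hH.isClosed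
  set B := pairing h2 hH.commutator_le χ with hB
  obtain ⟨U₁, hU₁, hU₁B⟩ := exists_nhds_pairing_eq_one h2 hH.commutator_le χ hH.le
  have hcB : Continuous fun p : G × G => B p.1 p.2 := continuous_pairing h2 hH.commutator_le χ
  have hU₂ : {g | |turn (B τ g)| < 1 / 8} ∈ 𝓝 (1 : G) := by
    have hc : Continuous fun g => B τ g := hcB.comp (Continuous.prodMk_right τ)
    have h : ContinuousAt (fun g => |turn (B τ g)|) 1 :=
      (ContinuousAt.comp_of_eq (f := fun g => B τ g) continuousAt_turn_one hc.continuousAt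
        (map_one (B τ))).abs
    refine h.eventually_lt continuousAt_const ?_
    simp [turn_one]
  have hU₃ : {p : G × G | |turn (B p.1 p.2)| < 1 / 8} ∈ 𝓝 ((1 : G), (1 : G)) := by
    have h : ContinuousAt (fun p : G × G => |turn (B p.1 p.2)|) (1, 1) :=
      (ContinuousAt.comp_of_eq (f := fun p : G × G => B p.1 p.2) continuousAt_turn_one
        hcB.continuousAt (by simp)).abs
    refine h.eventually_lt continuousAt_const ?_
    simp [turn_one]
  obtain ⟨U₃, hU₃n, U₃', hU₃n', hU₃s⟩ := mem_nhds_prod_iff.1 hU₃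
  have hU₄ : {p : G × G × G | p.1⁻¹ * p.2.1 * p.2.2 ∈ U₁} ∈ 𝓝 ((1 : G), (1 : G), (1 : G)) := by
    have h : Continuous fun p : G × G × G => p.1⁻¹ * p.2.1 * p.2.2 := by fun_prop
    exact h.continuousAt.preimage_mem_nhds (by simpa using hU₁)
  obtain ⟨U₄, hU₄n, Q, hQ, hU₄s⟩ := mem_nhds_prod_iff.1 hU₄
  obtain ⟨U₅, hU₅n, U₆, hU₆n, hQs⟩ := mem_nhds_prod_iff.1 hQ
  -- Pairings of elements of `U` with `τ` and with each other are close enough to `1` for `turn` to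
  -- be additive, and `a⁻¹ b c` stays in the neighbourhood where elements of `H` pair trivially.
  let U : Set G := {g | |turn (B τ g)| < 1 / 8} ∩ (U₃ ∩ U₃') ∩ (U₄ ∩ (U₅ ∩ U₆))
  have hU : U ∈ 𝓝 (1 : G) := Filter.inter_mem (Filter.inter_mem hU₂ (Filter.inter_mem hU₃n hU₃n'))
    (Filter.inter_mem hU₄n (Filter.inter_mem hU₅n hU₆n))
  have hτU : ∀ {g}, g ∈ U → |turn (B τ g)| < 1 / 8 := fun h => h.1.1
  have hBU : ∀ {g g'}, g ∈ U → g' ∈ U → |turn (B g g')| < 1 / 8 := fun h h' => by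
    have h0 := hU₃s (Set.mk_mem_prod h.1.2.1 h'.1.2.2)
    exact h0
  have hprod : ∀ {a b c}, a ∈ U → b ∈ U → c ∈ U → a⁻¹ * b * c ∈ U₁ := fun {a b c} ha hb hc =>
    hU₄s (Set.mk_mem_prod ha.2.1 (hQs (Set.mk_mem_prod hb.2.2.1 hc.2.2.2) : (b, c) ∈ Q))
  have h1U : (1 : G) ∈ U := mem_of_mem_nhds hU
  obtain ⟨ι, _, θ, hθ⟩ := exists_bohr_subset_nhds (τ : G ⧸ H)
    (W := ((↑) : G → G ⧸ H) '' U) (QuotientGroup.isOpenMap_coe.image_mem_nhds hU)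
  have hg : ∀ m : ℤ, ∃ g, ‖bohr θ m‖ < 1 / 8 → g ∈ U ∧ g⁻¹ * τ ^ m ∈ H := by
    intro m
    by_cases hm : ‖bohr θ m‖ < 1 / 8
    · obtain ⟨g, hgU, hg⟩ := hθ m hm
      exact ⟨g, fun _ => ⟨hgU, QuotientGroup.eq.1 hg⟩⟩
    · exact ⟨1, fun h => absurd h hm⟩
  choose g hg using hg
  have hgU : ∀ {m}, ‖bohr θ m‖ < 1 / 8 → g m ∈ U := fun hm => (hg _ hm).1
  have hgH : ∀ {m}, ‖bohr θ m‖ < 1 / 8 → ((g m : G) : G ⧸ H) = ((τ ^ m : G) : G ⧸ H) :=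
    fun hm => QuotientGroup.eq.2 (hg _ hm).2
  -- `g (m + m')` and `g m * g m'` agree modulo `H` up to a small element, which pairs trivially
  -- with everything. The arbitrary choice of representatives `g` is therefore harmless.
  have hadd : ∀ m m', ‖bohr θ m‖ < 1 / 8 → ‖bohr θ m'‖ < 1 / 8 → ‖bohr θ (m + m')‖ < 1 / 8 →
      ∀ x, B (g (m + m')) x = B (g m) x * B (g m') x := by
    intro m m' hm hm' hs x
    have h1 : (g (m + m'))⁻¹ * g m * g m' ∈ H := by
      rw [mul_assoc, ← QuotientGroup.eq, QuotientGroup.mk_mul, hgH hm, hgH hm', hgH hs, zpow_add,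
        QuotientGroup.mk_mul]
    have h3 := hU₁B _ (hprod (hgU hs) (hgU hm) (hgU hm')) h1 x
    rw [mul_assoc, map_mul, map_inv, map_mul] at h3
    exact inv_mul_eq_one.1 h3
  have hsw : ∀ x y, B y x = (B x y)⁻¹ := pairing_swap h2 hH.commutator_le χ
  have hself : ∀ x, B x x = 1 := pairing_self h2 hH.commutator_le χ
  have hadd' : ∀ m m', ‖bohr θ m‖ < 1 / 8 → ‖bohr θ m'‖ < 1 / 8 → ‖bohr θ (m + m')‖ < 1 / 8 →
      ∀ x, B x (g (m + m')) = B x (g m) * B x (g m') := by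
    intro m m' hm hm' hs x
    rw [hsw, hadd m m' hm hm' hs, mul_inv, ← hsw, ← hsw]
  obtain ⟨V, i₁, i₂, i₃, β, Λ, e, hd, hiso, hcpt, hnd, ε, hε, hmatch⟩ :=
    exists_isotropic_lattice θ (δ := 1 / 8) (by norm_num) (by norm_num)
      (ℓ := fun m => turn (B τ (g m))) (b := fun m m' => turn (B (g m) (g m')))
      (locallyAdditive_bohr (by norm_num) fun m m' hm hm' hs => by
        rw [hadd' m m' hm hm' hs, turn_mul (hτU (hgU hm)) (hτU (hgU hm'))])
      (fun m hm => (hτU (hgU hm)).le.trans (by norm_num))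
      (fun m m' hm hm' => (hBU (hgU hm) (hgU hm')).le.trans (by norm_num))
      (fun m'' hm'' => locallyAdditive_bohr (by norm_num) fun m m' hm hm' hs => by
        rw [hadd m m' hm hm' hs, turn_mul (hBU (hgU hm) (hgU hm'')) (hBU (hgU hm') (hgU hm''))])
      (fun m'' hm'' => locallyAdditive_bohr (by norm_num) fun m m' hm hm' hs => by
        rw [hadd' m m' hm hm' hs, turn_mul (hBU (hgU hm'') (hgU hm)) (hBU (hgU hm'') (hgU hm'))])
      (fun m m' hm hm' => by rw [hsw, turn_inv (hBU (hgU hm) (hgU hm'))])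
      (fun m m' hm hm' => by
        refine exists_int_of_fourierChar_eq_one ?_
        -- Both entries lie in `H`. Expanding bilinearly, with `B τ τ = 1`, yields the
        -- multiplicative form of the integrality condition.
        have h1 : B ((g m)⁻¹ * τ ^ m) ((g m')⁻¹ * τ ^ m') = 1 :=
          pairing_of_mem h2 hH.commutator_le χ (hg m hm).2 (hg m' hm').2
        simp only [map_mul, map_inv, map_zpow, MonoidHom.mul_apply, MonoidHom.inv_apply,
          MonoidHom.zpow_apply, hself, one_zpow, mul_one, inv_inv, hsw τ (g m)] at h1
        rw [AddChar.map_sub_eq_div, AddChar.map_add_eq_mul, ← zsmul_eq_mul, ← zsmul_eq_mul,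
          AddChar.map_zsmul_eq_zpow, AddChar.map_zsmul_eq_zpow, fourierChar_turn,
          fourierChar_turn, fourierChar_turn, ← h1]
        simp only [div_eq_mul_inv, mul_inv, inv_inv]
        ac_rfl)
  refine ⟨V, i₁, i₂, i₃, β, Λ, e, hd, hiso, hcpt, hnd, ε, hε, U, hU, ?_⟩
  intro m u v hu hv hmu hmv
  obtain ⟨hm, hℓ⟩ := hmatch m v hv hmv
  have h3 : (g m)⁻¹ * u * 1 ∈ H := by
    rw [mul_one, ← QuotientGroup.eq, hgH hm]
    exact QuotientGroup.eq.2 hmu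
  -- `u` and `g m` are small and congruent modulo `H`, so they have the same pairing with `τ`.
  have h4 := hU₁B _ (hprod (hgU hm) hu h1U) h3 τ
  rw [mul_one, map_mul, map_inv] at h4
  have h5 : B (g m) τ = B u τ := inv_mul_eq_one.1 h4
  rw [hℓ, fourierChar_turn, hsw, ← h5, ← hsw]

end LocalData

/-! ### Comparison of orbits and conclusion -/

section Orbits

open scoped commutatorElement

/-- Finitely many equivariant functions without common zero, and a dual family. -/
theorem IsVerticalSubgroup.exists_dual_families {G : Type*} [Group G] [TopologicalSpace G]
    [IsTopologicalGroup G] {Γ H : Subgroup G} [CompactSpace (G ⧸ Γ)] (hH : IsVerticalSubgroup Γ H)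
    (χ : H →ₜ* Circle) (hχ : ∀ h : H, (h : G) ∈ Γ → χ h = 1) :
    ∃ (t : Finset (G ⧸ Γ)) (b e : G ⧸ Γ → C(G ⧸ Γ, ℂ)), (∀ i, IsEquivariant χ (b i)) ∧
      (∀ i, IsEquivariant χ⁻¹ (e i)) ∧ ∀ x, ∑ i ∈ t, e i x * b i x = 1 := by
  have hb : ∀ x : G ⧸ Γ, ∃ f : C(G ⧸ Γ, ℂ), IsEquivariant χ f ∧ f x ≠ 0 := by
    intro x
    induction x using QuotientGroup.induction_on with | _ g
    exact hH.exists_isEquivariant_ne_zero χ hχ g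
  choose b hb hb0 using hb
  obtain ⟨t, ht⟩ := CompactSpace.elim_nhds_subcover (fun x => {y | b x y ≠ 0}) fun x =>
    (isOpen_ne_fun (b x).continuous continuous_const).mem_nhds (hb0 x)
  -- The dual functions are `star (b i) / D`. The denominator has no zero, and it is invariant under
  -- `H` because `χ` has modulus one.
  let D : G ⧸ Γ → ℝ := fun y => ∑ i ∈ t, ‖b i y‖ ^ 2
  have hD : ∀ y, D y ≠ 0 := by
    intro y
    have : y ∈ ⋃ x ∈ t, {y | b x y ≠ 0} := by rw [ht]; trivial
    obtain ⟨i, hi, hy⟩ := Set.mem_iUnion₂.1 this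
    refine (Finset.sum_pos' (fun i _ => by positivity) ⟨i, hi, ?_⟩).ne'
    exact pow_pos (norm_pos_iff.2 hy) 2
  have hDc : Continuous D := by fun_prop
  have hDC : ∀ y, (D y : ℂ) ≠ 0 := fun y => Complex.ofReal_ne_zero.2 (hD y)
  refine ⟨t, b, fun i => ⟨fun y => star (b i y) / (D y : ℂ), ?_⟩, hb, ?_, ?_⟩
  · exact ((b i).continuous.star).div (Complex.continuous_ofReal.comp hDc) hDC
  · intro i g h
    have h1 : D ((g * h : G) : G ⧸ Γ) = D (g : G ⧸ Γ) :=
      Finset.sum_congr rfl fun j _ => by rw [hb j, norm_mul, Circle.norm_coe, one_mul]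
    change star (b i ((g * h : G) : G ⧸ Γ)) / (D ((g * h : G) : G ⧸ Γ) : ℂ) =
      (((χ h)⁻¹ : Circle) : ℂ) * (star (b i (g : G ⧸ Γ)) / (D (g : G ⧸ Γ) : ℂ))
    rw [h1, hb i, star_mul', Circle.coe_inv_eq_conj, mul_div_assoc]
    rfl
  · intro x
    change ∑ i ∈ t, star (b i x) / (D x : ℂ) * b i x = 1
    have h1 : ∀ i, star (b i x) / (D x : ℂ) * b i x = ((‖b i x‖ ^ 2 : ℝ) : ℂ) / (D x : ℂ) := by
      intro i
      rw [div_mul_eq_mul_div]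
      congr 1
      rw [Complex.ofReal_pow]
      exact Complex.conj_mul' _
    simp only [h1]
    rw [← Finset.sum_div, ← Complex.ofReal_sum, div_self (hDC x)]

section General

variable {G : Type*} [Group G] [TopologicalSpace G] [IsTopologicalGroup G] {Γ H : Subgroup G}

theorem exists_nhds_eq_smul {U : Set G} (hU : U ∈ 𝓝 1) (x : G ⧸ Γ) :
    ∃ N ∈ 𝓝 x, ∀ y ∈ N, ∀ y' ∈ N, ∃ u ∈ U, y = u • y' := by
  induction x using QuotientGroup.induction_on with | _ g
  obtain ⟨W, hW, hWU⟩ := exists_nhds_split_inv hU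
  refine ⟨((↑) : G → G ⧸ Γ) '' ((fun w => w * g⁻¹) ⁻¹' W),
    QuotientGroup.isOpenMap_coe.image_mem_nhds ?_, ?_⟩
  · exact (continuous_mul_const g⁻¹).continuousAt.preimage_mem_nhds (by simpa using hW)
  · rintro _ ⟨a, ha, rfl⟩ _ ⟨a', ha', rfl⟩
    refine ⟨a * g⁻¹ / (a' * g⁻¹), hWU _ ha _ ha', ?_⟩
    change ((a : G) : G ⧸ Γ) = ((a * g⁻¹ / (a' * g⁻¹) * a' : G) : G ⧸ Γ)
    congr 1
    simp

omit [IsTopologicalGroup G] in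
theorem IsVerticalSubgroup.mem_of_zpow_smul_eq (hH : IsVerticalSubgroup Γ H) {τ u : G} {m m' : ℤ}
    {x : G ⧸ Γ} (h : τ ^ m • x = u • τ ^ m' • x) : (τ ^ (m - m'))⁻¹ * u ∈ H := by
  have hn := hH.normal
  induction x using QuotientGroup.induction_on with | _ g
  have h1 : ((τ ^ m * g : G) : G ⧸ Γ) = ((u * (τ ^ m' * g) : G) : G ⧸ Γ) := h
  have h2 := hn.conj_mem _ (hH.le (QuotientGroup.eq.1 h1)) (τ ^ m' * g)
  have h3 : τ ^ m' * g * ((τ ^ m * g)⁻¹ * (u * (τ ^ m' * g))) * (τ ^ m' * g)⁻¹ =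
      (τ ^ (m - m'))⁻¹ * u := by group
  rwa [h3] at h2

variable {G' : Type*} [Group G'] [TopologicalSpace G'] [IsTopologicalGroup G']
  {Γ' H' : Subgroup G'}

/-- The product of two equivariant orbit sequences with opposite commutator pairings is almost
periodic. -/
theorem mul_orbit_mem_unifClosure_expSeq [CompactSpace (G ⧸ Γ)] [CompactSpace (G' ⧸ Γ')]
    (hH : IsVerticalSubgroup Γ H) (h2 : commutator G ≤ Subgroup.center G)
    (hH' : IsVerticalSubgroup Γ' H') (h2' : commutator G' ≤ Subgroup.center G')
    {χ : H →ₜ* Circle} {χ' : H' →ₜ* Circle} {f : C(G ⧸ Γ, ℂ)} {f' : C(G' ⧸ Γ', ℂ)}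
    (hf : IsEquivariant χ f) (hf' : IsEquivariant χ' f') {τ : G} {τ' : G'}
    (hpair : ∃ U ∈ 𝓝 (1 : G), ∃ U' ∈ 𝓝 (1 : G'), ∀ (m : ℤ), ∀ u ∈ U, ∀ u' ∈ U',
      (τ ^ m)⁻¹ * u ∈ H → (τ' ^ m)⁻¹ * u' ∈ H' →
      pairing h2 hH.commutator_le χ τ u * pairing h2' hH'.commutator_le χ' τ' u' = 1)
    (x : G ⧸ Γ) (x' : G' ⧸ Γ') :
    (fun n : ℤ => f (τ ^ n • x) * f' (τ' ^ n • x')) ∈ unifClosure (Set.range expSeq) := by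
  refine mem_unifClosure_expSeq_of_compact (fun m => (τ ^ m • x, τ' ^ m • x'))
    (C := ‖f‖ * ‖f'‖) (fun n => ?_) fun ε hε => ?_
  · rw [norm_mul]
    gcongr <;> exact ContinuousMap.norm_coe_le_norm _ _
  obtain ⟨U, hU, U', hU', hUU⟩ := hpair
  have hε' : 0 < ε / (‖f‖ + ‖f'‖ + 1) := by positivity
  obtain ⟨W, hW, hWf⟩ := exists_nhds_smul_close f hε'
  obtain ⟨W', hW', hWf'⟩ := exists_nhds_smul_close f' hε'
  rintro ⟨z, z'⟩
  obtain ⟨N, hN, hNU⟩ := exists_nhds_eq_smul (Filter.inter_mem hU hW) z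
  obtain ⟨N', hN', hNU'⟩ := exists_nhds_eq_smul (Filter.inter_mem hU' hW') z'
  refine ⟨N ×ˢ N', prod_mem_nhds hN hN', fun m m' hm hm' n => ?_⟩
  obtain ⟨u, ⟨huU, huW⟩, hu⟩ := hNU _ hm.1 _ hm'.1
  obtain ⟨u', ⟨huU', huW'⟩, hu'⟩ := hNU' _ hm.2 _ hm'.2
  -- When the times `m` and `m'` bring both orbits near the same points, the two positions differ by
  -- small `u` and `u'`, which are congruent modulo `H` and `H'` to the powers with exponent `m -
  -- m'`. The phases at every time `n` therefore cancel, leaving only an error from uniform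
  -- continuity.
  have hB := hUU (m - m') u huU u' huU' (hH.mem_of_zpow_smul_eq hu) (hH'.mem_of_zpow_smul_eq hu')
  simp only at hu hu'
  have h1 : ((pairing h2 hH.commutator_le χ τ u ^ n : Circle) : ℂ) *
      ((pairing h2' hH'.commutator_le χ' τ' u' ^ n : Circle) : ℂ) = 1 := by
    rw [← Circle.coe_mul, ← mul_zpow, hB, one_zpow, Circle.coe_one]
  simp only [zpow_add, mul_smul]
  rw [hu, hu', hf.zpow_smul_smul h2 hH.commutator_le, hf'.zpow_smul_smul h2' hH'.commutator_le,
    mul_mul_mul_comm, h1, one_mul]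
  set y := τ ^ n • τ ^ m' • x
  set y' := τ' ^ n • τ' ^ m' • x'
  calc ‖f (u • y) * f' (u' • y') - f y * f' y'‖
      = ‖(f (u • y) - f y) * f' (u' • y') + f y * (f' (u' • y') - f' y')‖ := by congr 1; ring
    _ ≤ ε / (‖f‖ + ‖f'‖ + 1) * ‖f'‖ + ‖f‖ * (ε / (‖f‖ + ‖f'‖ + 1)) := by
        refine (norm_add_le _ _).trans ?_
        rw [norm_mul, norm_mul]
        gcongr
        · exact hWf u huW y
        · exact ContinuousMap.norm_coe_le_norm _ _
        · exact ContinuousMap.norm_coe_le_norm _ _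
        · exact hWf' u' huW' y'
    _ = ε * ((‖f‖ + ‖f'‖) / (‖f‖ + ‖f'‖ + 1)) := by ring
    _ ≤ ε * 1 := by
        gcongr
        rw [div_le_one (by positivity)]
        linarith
    _ = ε := mul_one ε

end General

/-- The partition `∑ d i * b i = 1` on the model writes the orbit sequence as a sum of `(f * d i) *
b i`. In `f * d i` the phases are opposite, so this factor is a limit of trigonometric polynomials,
and multiplying `b i` by an exponential keeps it basic elementary. -/
theorem orbit_mem_unifClosure_of_isEquivariant {G : Type} [Group G] [TopologicalSpace G]
    [IsTopologicalGroup G] {Γ H : Subgroup G} [CompactSpace (G ⧸ Γ)]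
    (hH : IsVerticalSubgroup Γ H) (h2 : commutator G ≤ Subgroup.center G) {χ : H →ₜ* Circle}
    {f : C(G ⧸ Γ, ℂ)} (hf : IsEquivariant χ f) (τ : G) (x : G ⧸ Γ) :
    (fun n : ℤ => f (τ ^ n • x)) ∈ unifClosure basicElementaryNilsequences := by
  obtain ⟨V, _, _, _, β, Λ, e, _, hiso, hcpt, hnd, ε, hε, U, hU, hmatch⟩ :=
    exists_model hH h2 χ τ
  obtain ⟨ρ, hρ⟩ := Heis.exists_splitting Λ hiso
  have hM := Heis.isVerticalSubgroup hiso hρ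
  have : CompactSpace (Heis β ⧸ Heis.lattice ρ) := Heis.compactSpace_quotient hρ hcpt
  obtain ⟨t, b, d, hb, hd, hbd⟩ := hM.exists_dual_families ρ fun h hh =>
    (Heis.mem_lattice.1 hh).2
  let τ' : Heis β := Heis.mk β e 1
  let z₀ : Heis β ⧸ Heis.lattice ρ := ((1 : Heis β) : Heis β ⧸ Heis.lattice ρ)
  have hsum : (fun n : ℤ => f (τ ^ n • x)) = ∑ i ∈ t,
      (fun n : ℤ => f (τ ^ n • x) * d i (τ' ^ n • z₀)) * fun n : ℤ => b i (τ' ^ n • z₀) := by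
    funext n
    rw [Finset.sum_apply]
    simp only [Pi.mul_apply, mul_assoc]
    rw [← Finset.mul_sum, hbd, mul_one]
  rw [hsum]
  refine Submodule.sum_mem _ fun i _ => mul_mem_unifClosure (S := Set.range expSeq) (C := ‖b i‖)
    (fun n => ContinuousMap.norm_coe_le_norm _ _) ?_ ?_
  · rintro _ ⟨z, rfl⟩
    exact subset_unifClosure (Heis.mul_mem_basicElementaryNilsequences hρ hcpt hnd (hb i) τ' z₀ z)
  · refine mul_orbit_mem_unifClosure_expSeq hH h2 hM Heis.commutator_le_center hf (hd i)
      ⟨U, hU, {p | ‖p.fst‖ < ε}, ?_, ?_⟩ x z₀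
    · refine (isOpen_lt (Heis.continuous_fst.norm) continuous_const).mem_nhds ?_
      simpa using hε
    · intro m u hu u' hu' hmu hmu'
      have h1 : u'.fst - m • e ∈ Λ := by
        rw [Heis.mem_vertical, Heis.fst_mul, Heis.fst_inv, Heis.fst_zpow, Heis.fst_mk,
          neg_add_eq_sub] at hmu'
        exact hmu'
      have h3 : pairing Heis.commutator_le_center hM.commutator_le ρ⁻¹ τ' u' =
          (pairing Heis.commutator_le_center hM.commutator_le ρ τ' u')⁻¹ := rfl
      rw [hmatch m u u'.fst hu hu' hmu h1, h3, Heis.pairing_eq hρ]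
      exact mul_inv_cancel _

theorem orbit_mem_unifClosure {G : Type} [Group G] [TopologicalSpace G] [IsTopologicalGroup G]
    [T2Space G] {Γ : Subgroup G} [DiscreteTopology Γ] [CompactSpace (G ⧸ Γ)]
    (h2 : commutator G ≤ Subgroup.center G) (f : C(G ⧸ Γ, ℂ)) (τ : G) (x : G ⧸ Γ) :
    (fun n : ℤ => f (τ ^ n • x)) ∈ unifClosure basicElementaryNilsequences := by
  have hH := isVerticalSubgroup_topologicalClosure h2 Γ
  refine mem_unifClosure_of_approx fun ε hε => ?_
  obtain ⟨f', hf', hff'⟩ := hH.exists_mem_span_isEquivariant_near f hε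
  refine ⟨fun n => f' (τ ^ n • x), ?_, fun n =>
    ((f - f').norm_coe_le_norm (τ ^ n • x)).trans hff'.le⟩
  clear hff'
  induction hf' using Submodule.span_induction with
  | mem g hg =>
    obtain ⟨χ, hg⟩ := hg
    exact orbit_mem_unifClosure_of_isEquivariant hH h2 hg τ x
  | zero => exact Submodule.zero_mem _
  | add g g' _ _ hg hg' => exact Submodule.add_mem _ hg hg'
  | smul c g _ hg => exact Submodule.smul_mem _ c hg

theorem basicNilsequences_subset :
    basicNilsequences ⊆ unifClosure basicElementaryNilsequences := by
  rintro _ ⟨N, f, x, rfl⟩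
  obtain ⟨_, E, _, _, _, H, _, I, _, _, _⟩ := N.isLie
  have := topologicalGroup_of_lieGroup I ∞ (G := N.G)
  have := N.discrete
  have := N.cocompact
  exact orbit_mem_unifClosure N.twoStep f N.τ x

theorem smul_mem_basicElementaryNilsequences (c : ℂ) {a : ℤ → ℂ}
    (ha : a ∈ basicElementaryNilsequences) : c • a ∈ basicElementaryNilsequences := by
  obtain ⟨N, f, x, hf, rfl⟩ := ha
  refine ⟨N, c • f, x, fun u y => ?_, rfl⟩
  rw [ContinuousMap.smul_apply, ContinuousMap.smul_apply, hf u y, smul_eq_mul, smul_eq_mul,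
    mul_left_comm]

/-- Stability of `S` under scalars lets the coefficients of a linear combination be absorbed into
its terms. -/
theorem isUniformLimitOf_finiteSums {S : Set (ℤ → ℂ)} (hS : ∀ (c : ℂ), ∀ a ∈ S, c • a ∈ S)
    {a : ℤ → ℂ} (ha : a ∈ unifClosure S) : IsUniformLimitOf (finiteSums S) a := by
  choose b hb hab using fun k : ℕ => ha (1 / ((k : ℝ) + 1)) (by positivity)
  refine ⟨b, fun k => ?_, ?_⟩
  · obtain ⟨n, r, g, hg⟩ := Submodule.mem_span_set'.1 (hb k)
    exact ⟨n, fun i => r i • (g i : ℤ → ℂ), fun i => hS _ _ (g i).2, hg.symm⟩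
  · rw [Metric.tendstoUniformly_iff]
    intro ε hε
    obtain ⟨K, hK⟩ := exists_nat_one_div_lt hε
    filter_upwards [Filter.eventually_ge_atTop K] with k hk n
    rw [dist_eq_norm]
    exact ((hab k n).trans (Nat.one_div_le_one_div hk)).trans_lt hK

theorem IsNilsequence.mem_unifClosure {a : ℤ → ℂ} (ha : IsNilsequence a) :
    a ∈ unifClosure basicElementaryNilsequences := by
  obtain ⟨b, hb, hab⟩ := ha
  rw [Metric.tendstoUniformly_iff] at hab
  refine mem_unifClosure_of_approx fun ε hε => ?_
  obtain ⟨k, hk⟩ := (hab ε hε).exists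
  exact ⟨b k, basicNilsequences_subset (hb k), fun n => by
    rw [← dist_eq_norm]; exact (hk n).le⟩

theorem basicElementaryNilsequences_subset : basicElementaryNilsequences ⊆ elementaryNilsequences :=
  fun a ha => Or.inl ⟨fun _ => a, fun _ => ha, by
    rw [Metric.tendstoUniformly_iff]
    exact fun ε hε => Filter.Eventually.of_forall fun _ n => by rwa [dist_self]⟩

end Orbits

end TwoStepNil

theorem mainTheorem6 (a : ℤ → ℂ) (ha : TwoStepNil.IsNilsequence a) :
    TwoStepNil.IsUniformLimitOf
        (TwoStepNil.finiteSums TwoStepNil.elementaryNilsequences) a ∧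
      TwoStepNil.IsUniformLimitOf
        (TwoStepNil.finiteSums TwoStepNil.basicElementaryNilsequences) a := by
  have h : TwoStepNil.IsUniformLimitOf
      (TwoStepNil.finiteSums TwoStepNil.basicElementaryNilsequences) a :=
    TwoStepNil.isUniformLimitOf_finiteSums
      (fun c _ ha => TwoStepNil.smul_mem_basicElementaryNilsequences c ha) ha.mem_unifClosure
  refine ⟨?_, h⟩
  obtain ⟨b, hb, hab⟩ := h
  refine ⟨b, fun k => ?_, hab⟩
  obtain ⟨n, s, hs, hk⟩ := hb k
  exact ⟨n, s, fun i => TwoStepNil.basicElementaryNilsequences_subset (hs i), hk⟩
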